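/- Setting. For $n\in\mathbb N$ let $S^n=\{1,\dots,n\}$ and $I^n_s=[(s-1)/n,s/n)$, $s\in S^n$. For $g\in L^2([0,1))$ let $\delta^n g=(\bar g^n_s)_{s\in S^n}$ with $\bar g^n_s=n\int_{I^n_s}g(u)\,du$, and for $z\in\mathbb R^{S^n}$ let $\iota^n z=\sum_{s\in S^n}z_s\mathbf 1_{I^n_s}$. Let $\mathscr R^n$ be the set of all discrete intervals $[i,j]\subset S^n$, $1\le i\le j\le n$. Fix an integer $p\ge 0$. A segmentation at stage $n$ is a pair $(\mathscr Q,h)$ of a partition $\mathscr Q$ of $S^n$ into elements of $\mathscr R^n$ and a function $h\in\mathbb R^{S^n}$ that on each $R\in\mathscr Q$ coincides with $\delta^n q_R$ for some polynomial $q_R$ of degree at most $p$. For $\gamma\ge 0$ and $y\in\mathbb R^{S^n}$ let $$H^n_\gamma(y,(\mathscr Q,h))=\gamma|\mathscr Q|+\frac1n\sum_{s\in S^n}(y_s-h_s)^2 .$$ Let $\mathbb M\subset\mathbb N$ be infinite (for example $\mathbb M=\mathbb N$); all limits and $O$-symbols are for $n\to\infty$, $n\in\mathbb M$. Let $\xi^n_s$,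 $n\in\mathbb M$, $s\in S^n$, be real random variables on a common probability space $(\Omega,\mathscr A,\mathbb P)$ which, for some $\beta>0$, satisfy $$\mathbb P\Big(\Big|\sum_{s\in S^n}\mu_s\xi^n_s\Big|\ge c\Big)\le 2\exp\Big(-\frac{c^2}{\beta\sum_{s\in S^n}\mu_s^2}\Big)$$ for all $n\in\mathbb M$, all real $(\mu_s)_{s\in S^n}$, not all zero, and all $c\ge0$. A function $f$ is called piecewise $W^{\alpha,2}([0,1])$ with $J$ jumps if there are points $0=x_0<x_1<\dots<x_{J+1}=1$ such that $f|_{(x_i,x_{i+1})}\in W^{\alpha,2}((x_i,x_{i+1}))$ for $i=0,\dots,J$, where $W^{\alpha,2}$ denotes the Sobolev (Sobolev–Slobodeckij, if $\alpha\notin\mathbb N$) space of order $\alpha$. Theorem. Let $0<\alpha<p+1$ and let $f$ be piecewise $W^{\alpha,2}([0,1])$ with finitely many jumps. Let $(\gamma_n)$ be a positive sequence with $$\gamma_n\to0\quad\text{and}\quad \gamma_n>\frac32\,\beta\,(p+1)\,\frac{\ln|\mathscr R^n|}{n}\ \text{ for all large } n\in\mathbb M .$$ For $n\in\mathbb M$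 and $\omega\in\Omega$ let $(\hat{\mathscr P}^n(\omega),\hat f^n(\omega))$ be any minimizer of $H^n_{\gamma_n}(\delta^n f+\xi^n(\omega),\cdot)$ over all segmentations at stage $n$. Then $$\|\iota^n\hat f^n(\omega)-f\|^2_{L^2([0,1))}=O\big(\gamma_n^{\frac{2\alpha}{2\alpha+1}}\big)\quad\text{for almost all }\omega\in\Omega .$$ In particular, if $C\ge 3\beta(p+1)$ is any constant (so $C$ may be chosen without knowledge of $f$ and $\alpha$) and the minimizers are taken with $\gamma_n=C\,\frac{\ln n}{n}$, then for every $\alpha\in(0,p+1)$ and every such $f$ $$\|\iota^n\hat f^n(\omega)-f\|^2_{L^2([0,1))}=O\Big(\Big(\frac{\ln n}{n}\Big)^{\frac{2\alpha}{2\alpha+1}}\Big)\quad\text{for almost all }\omega\in\Omega .$$ -/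

import Mathlib

open MeasureTheory Filter Set Topology Asymptotics

/-! ### Fractional Sobolev spaces on bounded intervals, piecewise Sobolev functions -/

/-- `g` is the weak derivative of order `j` of `f` on the open interval `(a, b)`. -/
def HasWeakDerivOn (a b : ℝ) (j : ℕ) (f g : ℝ → ℝ) : Prop :=
  ∀ φ : ℝ → ℝ, ContDiff ℝ ((⊤ : ℕ∞) : WithTop ℕ∞) φ → HasCompactSupport φ → tsupport φ ⊆ Ioo a b →
    ∫ x in Ioo a b, f x * iteratedDeriv j φ x = (-1) ^ j * ∫ x in Ioo a b, g x * φ x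

/-- The (squared) Gagliardo–Slobodeckij seminorm of order `s` of `g` on `(a, b)`. -/
noncomputable def gagliardoSq (a b s : ℝ) (g : ℝ → ℝ) : ENNReal :=
  ∫⁻ x in Ioo a b, ∫⁻ y in Ioo a b, ENNReal.ofReal (|g x - g y| ^ 2 / |x - y| ^ (1 + 2 * s))

/-- `f` belongs to the Sobolev–Slobodeckij space `W^{α,2}((a, b))`, `α ≥ 0`: it is in `L²`, its
weak derivatives of all orders `j ≤ ⌊α⌋` are in `L²`, and, if `α` is not an integer, the weak
derivative of order `⌊α⌋` has a finite Gagliardo seminorm of order `α - ⌊α⌋`. -/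
def MemSobolev (α a b : ℝ) (f : ℝ → ℝ) : Prop :=
  MemLp f 2 (volume.restrict (Ioo a b)) ∧
  ∃ g : ℕ → ℝ → ℝ,
    (∀ j ≤ ⌊α⌋₊, MemLp (g j) 2 (volume.restrict (Ioo a b)) ∧ HasWeakDerivOn a b j f (g j)) ∧
    (0 < Int.fract α → gagliardoSq a b (Int.fract α) (g ⌊α⌋₊) < ⊤)

/-- `f` is piecewise `W^{α,2}` on `[0, 1]` with `J` jumps: for some points
`0 = x₀ < x₁ < ⋯ < x_{J+1} = 1`, `f` is `W^{α,2}` on each interval `(x_i, x_{i+1})`. -/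
def PiecewiseSobolev (α : ℝ) (J : ℕ) (f : ℝ → ℝ) : Prop :=
  ∃ x : Fin (J + 2) → ℝ, StrictMono x ∧ x 0 = 0 ∧ x (Fin.last (J + 1)) = 1 ∧
    ∀ i : Fin (J + 1), MemSobolev α (x i.castSucc) (x i.succ) f

/-! ### Discretization: the grid `S^n` is `Fin n`, its point `s` standing for `s + 1` -/

/-- The cell `[s/n, (s+1)/n)`. -/
def gridCell (n : ℕ) (s : Fin n) : Set ℝ :=
  Ico ((s : ℝ) / n) (((s : ℝ) + 1) / n)

/-- The discretization `δ^n g`: the vector of the means of `g` over the `n` cells. -/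
noncomputable def gridMean (n : ℕ) (g : ℝ → ℝ) : Fin n → ℝ :=
  fun s => n * ∫ u in gridCell n s, g u

/-- The embedding `ι^n z`: the step function with value `z s` on the `s`-th cell. -/
noncomputable def gridEmbed (n : ℕ) (z : Fin n → ℝ) : ℝ → ℝ :=
  fun u => ∑ s, (gridCell n s).indicator (fun _ => z s) u

/-- The squared distance `‖ι^n z - f‖²` in `L²([0, 1))`. -/
noncomputable def sqError (n : ℕ) (z : Fin n → ℝ) (f : ℝ → ℝ) : ℝ :=
  ∫ u in Ico (0 : ℝ) 1, (gridEmbed n z u - f u) ^ 2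

/-! ### Segmentations and the penalized least squares estimator -/

/-- The admissible fragments: all discrete intervals `[i, j]`, `i ≤ j`, of `S^n`. -/
def intervalFragments (n : ℕ) : Finset (Finset (Fin n)) :=
  (Finset.univ.filter fun q : Fin n × Fin n => q.1 ≤ q.2).image fun q => Finset.Icc q.1 q.2

/-- The admissible partitions: the partitions of `S^n` into discrete intervals. -/
def IsIntervalPartition {n : ℕ} (Q : Finpartition (Finset.univ : Finset (Fin n))) : Prop :=
  Q.parts ⊆ intervalFragments n

/-- The space of functions on `S^n` of the form `1_R · δ^n q`, `q` a polynomial of degree at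
most `p`. -/
noncomputable def fragmentSpace (p n : ℕ) (R : Finset (Fin n)) : Submodule ℝ (Fin n → ℝ) :=
  Submodule.span ℝ {h | ∃ q : Polynomial ℝ, q.natDegree ≤ p ∧
    h = (R : Set (Fin n)).indicator (gridMean n fun u => q.eval u)}

/-- The space of piecewise polynomial functions on `S^n` relative to a partition. -/
noncomputable def partitionSpace (p : ℕ) {n : ℕ}
    (Q : Finpartition (Finset.univ : Finset (Fin n))) : Submodule ℝ (Fin n → ℝ) :=
  ⨆ R ∈ Q.parts, fragmentSpace p n R

/-- The segmentations: pairs of an interval partition and a piecewise polynomial function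
relative to it. -/
def IsSegmentation (p : ℕ) {n : ℕ} (Q : Finpartition (Finset.univ : Finset (Fin n)))
    (h : Fin n → ℝ) : Prop :=
  IsIntervalPartition Q ∧ h ∈ partitionSpace p Q

/-- The complexity penalized least squares functional `γ |Q| + ‖y - h‖² / |S^n|`. -/
noncomputable def penalizedLS (γ : ℝ) {n : ℕ} (y : Fin n → ℝ)
    (Q : Finpartition (Finset.univ : Finset (Fin n))) (h : Fin n → ℝ) : ℝ :=
  γ * Q.parts.card + (∑ s, (y s - h s) ^ 2) / n

/-- The segmentation `(Q, h)` minimizes the penalized least squares functional for the data `y`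
among all segmentations. -/
def IsEstimate (p : ℕ) (γ : ℝ) {n : ℕ} (y : Fin n → ℝ)
    (Q : Finpartition (Finset.univ : Finset (Fin n))) (h : Fin n → ℝ) : Prop :=
  IsSegmentation p Q h ∧
    ∀ Q' h', IsSegmentation p Q' h' → penalizedLS γ y Q h ≤ penalizedLS γ y Q' h'

/-! ### Noise and penalty -/

/-- The sub-Gaussian tail condition with scale factor `β`, at all stages `n ∈ M`. -/
def TailCondition {Ω : Type*} [MeasurableSpace Ω] (P : Measure Ω) (M : Set ℕ) (β : ℝ)
    (ξ : (n : ℕ) → Fin n → Ω → ℝ) : Prop :=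
  ∀ n ∈ M, ∀ μ : Fin n → ℝ, ∀ c : ℝ, 0 ≤ c →
    P.real {ω | c ≤ |∑ s, μ s * ξ n s ω|} ≤ 2 * Real.exp (-(c ^ 2 / (β * ∑ s, μ s ^ 2)))

/-- `n → ∞` along `M`. -/
def along (M : Set ℕ) : Filter ℕ := atTop ⊓ 𝓟 M

/-- The condition on the penalty parameters: `γ` is positive, tends to `0`, and eventually
`γ n > C ln |R^n| / |S^n|` with `C = β D (κ + 1) / κ`. Here `D` bounds the dimensions of the
spaces of the fragments and `|R^n|` grows at least as `n ^ κ`. -/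
def PenaltyCondition (M : Set ℕ) (β D κ : ℝ) (γ : ℕ → ℝ) : Prop :=
  (∀ n ∈ M, 0 < γ n) ∧ Tendsto γ (along M) (𝓝 0) ∧
    ∀ᶠ n in along M,
      β * D * (κ + 1) / κ * (Real.log ((intervalFragments n).card : ℝ) / n) < γ n

/-! The proof combines a deterministic oracle inequality, an approximation bound for `f`, and a
uniform almost sure noise bound.

Oracle inequality (`oracle_inequality`). Suppose `⟨v, ξ⟩² ≤ θ n γ ‖v‖²` with a fixed `θ < 1`, for
all `v` in all fragment spaces. Comparing the minimizer `(Q', h')` with any segmentation `(Q, h)`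
leaves the cross term `2 ⟨h' - h, ξ⟩`. The common refinement of two interval partitions has at most
`|Q| + |Q'|` parts, and on each of them `h' - h` lies in a fragment space, so the cross term is at
most `n γ (|Q| + |Q'|) + θ ‖h' - h‖²`. The penalty cancels `|Q'|`, and `θ < 1` lets the last term be
absorbed. Up to a factor depending on `θ`, the error is thus at most `γ |Q| + ‖f - h‖² / n`.

Approximation (`MemSobolev.exists_poly_approx`, `exists_segmentation`). Away from breaks, `f` is
approximated on an interval `I` by a polynomial with squared error at most `|I| ^ (2 α) ν(I)` for
one finite measure `ν`. Blocks of length `l` therefore have total error `O(l ^ (2 α))` and cost `γ /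
l`; the two balance at `l = γ ^ (1 / (2 α + 1))`. Cells that contain a break become parts of their
own. Replacing `f` by its cell means costs no more than the rate: on break cells this rests on
`MemSobolev.exists_integral_sq_le`, which does not need `f` to be bounded.

Noise (`TailCondition.ae_eventually_fragment_le`). Since `|R^n|` is about `n ^ 2 / 2`, the penalty
is only guaranteed to exceed a multiple of `ln n` slightly smaller than `3 β (p + 1)`, whereas
Borel–Cantelli with a union bound over all intervals needs a tail exponent above `3`. For `p ≥ 1`
the missing room comes from test vectors that lose `√(p + 1)` instead of `p + 1`
(`exists_test_vectors`). For `p = 0` it comes from a family of only about `n ^ 1.5` intervals that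
controls all others up to a factor tending to `1` (`abs_sum_intervalVector_le`). -/

/-! ### Weak derivatives of first order are primitives -/

/-- The fundamental lemma of the calculus of variations. -/
theorem ae_eq_zero_of_test {a b : ℝ} {f : ℝ → ℝ} (hf : IntegrableOn f (Ioo a b))
    (h : ∀ φ : ℝ → ℝ, ContDiff ℝ ((⊤ : ℕ∞) : WithTop ℕ∞) φ → HasCompactSupport φ →
      tsupport φ ⊆ Ioo a b → ∫ x in Ioo a b, f x * φ x = 0) :
    ∀ᵐ x ∂(volume.restrict (Ioo a b)), f x = 0 := by
  rw [ae_restrict_iff' measurableSet_Ioo]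
  refine isOpen_Ioo.ae_eq_zero_of_integral_contDiff_smul_eq_zero hf.locallyIntegrableOn ?_
  intro φ h1 h2 h3
  rw [← h φ h1 h2 h3, ← setIntegral_eq_integral_of_forall_compl_eq_zero (s := Ioo a b)]
  · simp [mul_comm]
  · intro x hx
    rw [image_eq_zero_of_notMem_tsupport (fun h' => hx (h3 h')), zero_smul]

theorem MeasureTheory.IntegrableOn.mul_continuous_Ioo {a b : ℝ} {f φ : ℝ → ℝ} (hf : IntegrableOn f (Ioo a b))
    (hφ : Continuous φ) : IntegrableOn (fun x => f x * φ x) (Ioo a b) :=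
  hf.mul_continuousOn_of_subset hφ.continuousOn measurableSet_Ioo isCompact_Icc Ioo_subset_Icc_self

theorem HasWeakDerivOn.ae_eq {a b : ℝ} {f g : ℝ → ℝ} (h : HasWeakDerivOn a b 0 f g)
    (hf : IntegrableOn f (Ioo a b)) (hg : IntegrableOn g (Ioo a b)) :
    f =ᵐ[volume.restrict (Ioo a b)] g := by
  have := ae_eq_zero_of_test (f := fun x => f x - g x) (hf.sub hg) (fun φ h1 h2 h3 => by
    have := h φ h1 h2 h3
    simp only [iteratedDeriv_zero, pow_zero, one_mul] at this
    simp only [sub_mul]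
    rw [integral_sub (hf.mul_continuous_Ioo h1.continuous) (hg.mul_continuous_Ioo h1.continuous),
      this, sub_self])
  filter_upwards [this] with x hx using sub_eq_zero.1 hx

/-- The derivative of a test function is a test function; inserting it into the identity of order
`j` and comparing with that of order `j + 1` cancels `f`. -/
theorem HasWeakDerivOn.succ {a b : ℝ} {j : ℕ} {f g g' : ℝ → ℝ} (h : HasWeakDerivOn a b j f g)
    (h' : HasWeakDerivOn a b (j + 1) f g') : HasWeakDerivOn a b 1 g g' := by
  intro φ h1 h2 h3
  have e1 := h (deriv φ) (contDiff_infty_iff_deriv.1 h1).2 h2.deriv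
    ((closure_minimal support_deriv_subset (isClosed_tsupport _)).trans h3)
  have e2 := h' φ h1 h2 h3
  rw [iteratedDeriv_succ'] at e2
  rw [e2, pow_succ] at e1
  simp only [iteratedDeriv_one, pow_one]
  have : ((-1 : ℝ) ^ j) ≠ 0 := by positivity
  apply mul_left_cancel₀ this
  rw [← e1]; ring

/-- A compactly supported smooth function of integral zero has a compactly supported smooth
primitive. -/
theorem exists_test_primitive {a b : ℝ} {η : ℝ → ℝ}
    (h1 : ContDiff ℝ ((⊤ : ℕ∞) : WithTop ℕ∞) η) (h2 : HasCompactSupport η)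
    (h3 : tsupport η ⊆ Ioo a b) (h0 : ∫ x in Ioo a b, η x = 0) :
    ∃ φ : ℝ → ℝ, ContDiff ℝ ((⊤ : ℕ∞) : WithTop ℕ∞) φ ∧ HasCompactSupport φ ∧
      tsupport φ ⊆ Ioo a b ∧ deriv φ = η := by
  rcases (tsupport η).eq_empty_or_nonempty with he | hne
  · refine ⟨0, contDiff_const, HasCompactSupport.zero, by simp, ?_⟩
    have : η = 0 := tsupport_eq_empty_iff.1 he
    rw [this]; ext x; simp
  obtain ⟨a', ha'⟩ := IsCompact.exists_isLeast h2 hne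
  obtain ⟨b', hb'⟩ := IsCompact.exists_isGreatest h2 hne
  have haa := h3 ha'.1
  have hbb := h3 hb'.1
  have hz : ∀ x, x ∉ Icc a' b' → η x = 0 := fun x hx =>
    image_eq_zero_of_notMem_tsupport fun h => hx ⟨ha'.2 h, hb'.2 h⟩
  have hd : ∀ x, HasDerivAt (fun x => ∫ t in a..x, η t) (η x) x := fun x =>
    h1.continuous.integral_hasStrictDerivAt a x |>.hasDerivAt
  have hder : deriv (fun x => ∫ t in a..x, η t) = η := funext fun x => (hd x).deriv
  have hs : Function.support (fun x => ∫ t in a..x, η t) ⊆ Icc a' b' := by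
    intro x hx
    by_contra hx'
    apply hx
    rcases lt_or_ge x a' with hlt | hge
    · apply intervalIntegral.integral_zero_ae
      refine Eventually.of_forall fun t ht => hz t fun ht' => ?_
      have : t ≤ max a x := ht.2
      have := max_lt haa.1 hlt
      linarith [ht'.1]
    -- To the right of the support the primitive equals the full integral of `η`, which is zero by
    -- `h0`.
    · have hlt : b' < x := by
        by_contra hh
        exact hx' ⟨hge, not_lt.1 hh⟩
      have hI : ∀ u v, IntervalIntegrable η volume u v := fun u v =>
        h1.continuous.intervalIntegrable u v
      have e : (∫ t in a..x, η t) = (∫ t in a..b, η t) + ∫ t in b..x, η t :=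
        (intervalIntegral.integral_add_adjacent_intervals (hI _ _) (hI _ _)).symm
      have e1 : (∫ t in a..b, η t) = 0 := by
        rw [intervalIntegral.integral_of_le (haa.1.trans haa.2).le, integral_Ioc_eq_integral_Ioo, h0]
      have e2 : (∫ t in b..x, η t) = 0 := by
        apply intervalIntegral.integral_zero_ae
        refine Eventually.of_forall fun t ht => hz t fun ht' => ?_
        have : min b x < t := ht.1
        have := lt_min hbb.2 hlt
        linarith [ht'.2]
      simp only [e, e1, e2, add_zero]
  have hts : tsupport (fun x => ∫ t in a..x, η t) ⊆ Icc a' b' :=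
    closure_minimal hs isClosed_Icc
  refine ⟨fun x => ∫ t in a..x, η t, ?_, ?_, ?_, hder⟩
  · rw [contDiff_infty_iff_deriv, hder]
    exact ⟨fun x => (hd x).differentiableAt, h1⟩
  · exact isCompact_Icc.of_isClosed_subset (isClosed_tsupport _) hts
  · exact hts.trans (Icc_subset_Ioo haa.1 hbb.2)

/-- The lemma of du Bois-Reymond. -/
theorem ae_const_of_test_deriv {a b : ℝ} (hab : a < b) {f : ℝ → ℝ}
    (hf : IntegrableOn f (Ioo a b))
    (h : ∀ φ : ℝ → ℝ, ContDiff ℝ ((⊤ : ℕ∞) : WithTop ℕ∞) φ → HasCompactSupport φ →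
      tsupport φ ⊆ Ioo a b → ∫ x in Ioo a b, f x * deriv φ x = 0) :
    ∃ C, ∀ᵐ x ∂(volume.restrict (Ioo a b)), f x = C := by
  let B : ContDiffBump ((a + b) / 2) := ⟨(b - a) / 8, (b - a) / 4, by linarith, by linarith⟩
  set ρ : ℝ → ℝ := B.normed volume with hρ
  have ρ1 : ContDiff ℝ ((⊤ : ℕ∞) : WithTop ℕ∞) ρ := B.contDiff_normed
  have ρ2 : HasCompactSupport ρ := B.hasCompactSupport_normed
  have ρ3 : tsupport ρ ⊆ Ioo a b := by
    rw [hρ, B.tsupport_normed_eq, Real.closedBall_eq_Icc]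
    apply Icc_subset_Ioo
    · change a < (a + b) / 2 - (b - a) / 4
      linarith
    · change (a + b) / 2 + (b - a) / 4 < b
      linarith
  have int_eq : ∀ ψ : ℝ → ℝ, tsupport ψ ⊆ Ioo a b → ∫ x in Ioo a b, ψ x = ∫ x, ψ x :=
    fun ψ hψ => setIntegral_eq_integral_of_forall_compl_eq_zero fun x hx =>
      image_eq_zero_of_notMem_tsupport fun h' => hx (hψ h')
  have ρ4 : ∫ x in Ioo a b, ρ x = 1 := by
    rw [int_eq ρ ρ3]; exact B.integral_normed
  set C := ∫ x in Ioo a b, f x * ρ x with hC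
  refine ⟨C, ?_⟩
  have := ae_eq_zero_of_test (f := fun x => f x - C)
    (hf.sub (integrableOn_const (by simp))) (fun ψ h1 h2 h3 => ?_)
  · filter_upwards [this] with x hx using sub_eq_zero.1 hx
  have hψi : IntegrableOn ψ (Ioo a b) :=
    (h1.continuous.integrable_of_hasCompactSupport h2).integrableOn
  have hρi : IntegrableOn ρ (Ioo a b) :=
    (ρ1.continuous.integrable_of_hasCompactSupport ρ2).integrableOn
  set I := ∫ x in Ioo a b, ψ x with hI
  -- Subtracting `I * ρ` removes the integral of `ψ`, so the difference is the derivative of a test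
  -- function. Testing with it gives `∫ f ψ = C I`.
  obtain ⟨φ, φ1, φ2, φ3, φ4⟩ := exists_test_primitive (a := a) (b := b)
    (η := fun x => ψ x - I * ρ x) (h1.sub (contDiff_const.mul ρ1)) (h2.sub (ρ2.mul_left))
    ((tsupport_sub _ _).trans (union_subset h3 ((tsupport_mul_subset_right).trans ρ3)))
    (by rw [integral_sub hψi (hρi.const_mul I), integral_const_mul, ρ4, mul_one, sub_self])
  have key := h φ φ1 φ2 φ3
  rw [φ4] at key
  have e1 : ∀ x, f x * (ψ x - I * ρ x) = f x * ψ x - I * (f x * ρ x) := fun x => by ring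
  simp only [e1] at key
  rw [integral_sub (hf.mul_continuous_Ioo h1.continuous)
    ((hf.mul_continuous_Ioo ρ1.continuous).const_mul I), integral_const_mul] at key
  simp only [sub_mul]
  rw [integral_sub (hf.mul_continuous_Ioo h1.continuous) (hψi.const_mul C), integral_const_mul]
  linarith

/-- A function with an integrable weak derivative is almost everywhere a primitive of it. -/
theorem HasWeakDerivOn.exists_primitive {a b : ℝ} (hab : a < b) {u v : ℝ → ℝ}
    (h : HasWeakDerivOn a b 1 u v) (hu : IntegrableOn u (Ioo a b))
    (hv : IntegrableOn v (Ioo a b)) :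
    ∃ C, ∀ᵐ x ∂(volume.restrict (Ioo a b)), u x = C + ∫ t in a..x, v t := by
  have hvi : IntervalIntegrable v volume a b := by
    rw [intervalIntegrable_iff_integrableOn_Ioo_of_le hab.le]; exact hv
  have hV := hvi.absolutelyContinuousOnInterval_intervalIntegral (c := a) (by simp)
  have hVc : ContinuousOn (fun x => ∫ t in a..x, v t) (Icc a b) := by
    have := hV.continuousOn
    rwa [uIcc_of_le hab.le] at this
  have hVi : IntegrableOn (fun x => ∫ t in a..x, v t) (Ioo a b) :=
    (hVc.integrableOn_Icc).mono_set Ioo_subset_Icc_self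
  suffices hw : ∀ φ : ℝ → ℝ, ContDiff ℝ ((⊤ : ℕ∞) : WithTop ℕ∞) φ → HasCompactSupport φ →
      tsupport φ ⊆ Ioo a b → ∫ x in Ioo a b, (u x - ∫ t in a..x, v t) * deriv φ x = 0 by
    obtain ⟨C, hC⟩ := ae_const_of_test_deriv hab
      (f := fun x => u x - ∫ t in a..x, v t) (hu.sub hVi) hw
    refine ⟨C, ?_⟩
    filter_upwards [hC] with x hx
    linarith
  intro φ φ1 φ2 φ3
  have d1 := (contDiff_infty_iff_deriv.1 φ1).2.continuous
  have hz : ∀ x, x ∉ Ioo a b → φ x = 0 := fun x hx =>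
    image_eq_zero_of_notMem_tsupport fun h => hx (φ3 h)
  have hφ : AbsolutelyContinuousOnInterval φ a b :=
    (φ1.of_le (by exact_mod_cast le_top)).contDiffOn.absolutelyContinuousOnInterval
  -- Integration by parts for absolutely continuous functions; the boundary terms vanish because `φ`
  -- does at `a` and `b`.
  have ibp := hV.integral_mul_deriv_eq_deriv_mul hφ
  rw [hz a (by simp), hz b (by simp)] at ibp
  have hw := h φ φ1 φ2 φ3
  simp only [iteratedDeriv_one, pow_one] at hw
  simp only [sub_mul]
  rw [integral_sub (hu.mul_continuous_Ioo d1) (hVi.mul_continuous_Ioo d1), hw]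
  simp only [intervalIntegral.integral_of_le hab.le, integral_Ioc_eq_integral_Ioo] at ibp
  rw [ibp]
  have hder : ∀ᵐ x ∂(volume.restrict (Ioo a b)),
      deriv (fun x => ∫ t in a..x, v t) x * φ x = v x * φ x := by
    rw [ae_restrict_iff' measurableSet_Ioo]
    filter_upwards [hvi.ae_hasDerivAt_integral] with x hx hxm
    rw [(hx (by rw [uIcc_of_le hab.le]; exact Ioo_subset_Icc_self hxm) a (by simp)).deriv]
  rw [integral_congr_ae hder]
  ring


/-! ### Local polynomial approximation of Sobolev functions -/

/-- Cauchy–Schwarz against the constant `1`, from `∫ (h - t)² ≥ 0` at the mean `t = A / V`. -/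
theorem sq_integral_le {X : Type*} [MeasurableSpace X] {μ : Measure X} [IsFiniteMeasure μ]
    {h : X → ℝ} (hh : MemLp h 2 μ) : (∫ x, h x ∂μ) ^ 2 ≤ μ.real univ * ∫ x, h x ^ 2 ∂μ := by
  set V := μ.real univ with hV
  set A := ∫ x, h x ∂μ with hA
  set B := ∫ x, h x ^ 2 ∂μ with hB
  have hi : Integrable h μ := hh.integrable (by norm_num)
  have key : ∀ t : ℝ, 0 ≤ B - 2 * t * A + t ^ 2 * V := by
    intro t
    have h0 : 0 ≤ ∫ x, (h x - t) ^ 2 ∂μ := integral_nonneg fun x => sq_nonneg _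
    have e : ∀ x, (h x - t) ^ 2 = h x ^ 2 - 2 * t * h x + t ^ 2 := fun x => by ring
    simp only [e] at h0
    rw [integral_add (f := fun x => h x ^ 2 - 2 * t * h x)
        (hh.integrable_sq.sub (hi.const_mul _)) (integrable_const _),
      integral_sub hh.integrable_sq (hi.const_mul _), integral_const_mul, integral_const] at h0
    simp only [smul_eq_mul] at h0
    linarith
  rcases (measureReal_nonneg : 0 ≤ V).eq_or_lt with h0 | hpos
  · have : μ = 0 := by
      rw [← Measure.measure_univ_eq_zero]
      exact (measureReal_eq_zero_iff).1 h0.symm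
    rw [hV, ← h0, hA, this]; simp
  · have := key (A / V)
    have e : B - 2 * (A / V) * A + (A / V) ^ 2 * V = B - A ^ 2 / V := by
      field_simp; ring
    rw [e, sub_nonneg, div_le_iff₀ hpos] at this
    linarith

theorem Polynomial.exists_derivative_eq {e : ℕ} {q : Polynomial ℝ} (hq : q.natDegree ≤ e) :
    ∃ Q : Polynomial ℝ, Q.natDegree ≤ e + 1 ∧ Polynomial.derivative Q = q := by
  refine ⟨∑ i ∈ Finset.range (e + 1), Polynomial.C (q.coeff i / (i + 1)) * Polynomial.X ^ (i + 1),
    ?_, ?_⟩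
  · apply Polynomial.natDegree_sum_le_of_forall_le
    intro i hi
    refine (Polynomial.natDegree_C_mul_X_pow_le _ _).trans ?_
    simpa using hi
  · conv_rhs => rw [q.as_sum_range' (e + 1) (by omega)]
    rw [Polynomial.derivative_sum]
    refine Finset.sum_congr rfl fun i _ => ?_
    rw [Polynomial.derivative_C_mul_X_pow, ← Polynomial.C_mul_X_pow_eq_monomial]
    congr 2
    push_cast
    field_simp

theorem memLp_polynomial_Ioo (q : Polynomial ℝ) (a b : ℝ) :
    MemLp (fun x => q.eval x) 2 (volume.restrict (Ioo a b)) := by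
  obtain ⟨K, hK⟩ := isCompact_Icc.exists_bound_of_continuousOn (s := Icc a b)
    q.continuous.continuousOn
  refine MemLp.of_bound q.continuous.aestronglyMeasurable K ?_
  filter_upwards [ae_restrict_mem measurableSet_Ioo] with x hx
  exact hK x (Ioo_subset_Icc_self hx)

theorem volume_real_Ioo_univ {c d : ℝ} (hcd : c ≤ d) :
    (volume.restrict (Ioo c d)).real univ = d - c := by
  rw [measureReal_restrict_apply_univ, Real.volume_real_Ioo_of_le hcd]

/-- One integration step for local polynomial approximations. -/
theorem exists_poly_approx_of_primitive {a b c d : ℝ} (hac : a ≤ c) (hcd : c < d) (hdb : d ≤ b)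
    {u v : ℝ → ℝ} {K : ℝ} (hv : MemLp v 2 (volume.restrict (Ioo a b)))
    (huv : ∀ᵐ x ∂(volume.restrict (Ioo a b)), u x = K + ∫ t in a..x, v t)
    {e : ℕ} {q : Polynomial ℝ} (hq : q.natDegree ≤ e) :
    ∃ Q : Polynomial ℝ, Q.natDegree ≤ e + 1 ∧ Polynomial.derivative Q = q ∧
      ∫ x in Ioo c d, (u x - Q.eval x) ^ 2 ≤ (d - c) ^ 2 * ∫ x in Ioo c d, (v x - q.eval x) ^ 2 := by
  obtain ⟨Q₀, hQ₀, hQ₀'⟩ := Polynomial.exists_derivative_eq hq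
  have hsub : Ioo c d ⊆ Ioo a b := Ioo_subset_Ioo hac hdb
  have hvi : IntegrableOn v (Ioo a b) := hv.integrable (by norm_num)
  have hvI : ∀ x y, x ∈ Icc a b → y ∈ Icc a b → IntervalIntegrable v volume x y := by
    intro x y hx hy
    have : IntervalIntegrable v volume a b := by
      rwa [intervalIntegrable_iff_integrableOn_Ioo_of_le (hx.1.trans hx.2)]
    refine this.mono_set ?_
    rw [uIcc_of_le (hx.1.trans hx.2)]
    exact uIcc_subset_Icc hx hy
  -- The constant makes the polynomial agree at `c` with the primitive `K + ∫ v`, so the error at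
  -- `x` is the integral of `v - q` over `(c, x)`. Cauchy–Schwarz and the integration in `x`
  -- contribute one factor `d - c` each.
  refine ⟨Q₀ + Polynomial.C (K + (∫ t in a..c, v t) - Q₀.eval c), ?_, by simp [hQ₀'], ?_⟩
  · exact (Polynomial.natDegree_add_C).trans_le hQ₀
  set w : ℝ → ℝ := fun x => v x - q.eval x with hw
  have hwL : MemLp w 2 (volume.restrict (Ioo c d)) :=
    (hv.mono_measure (Measure.restrict_mono hsub le_rfl)).sub (memLp_polynomial_Ioo q c d)
  set B := ∫ x in Ioo c d, w x ^ 2 with hB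
  have hB0 : 0 ≤ B := integral_nonneg fun x => sq_nonneg _
  have hae : ∀ᵐ x ∂(volume.restrict (Ioo c d)),
      (u x - (Q₀ + Polynomial.C (K + (∫ t in a..c, v t) - Q₀.eval c)).eval x) ^ 2
        ≤ (d - c) * B := by
    filter_upwards [ae_restrict_of_ae_restrict_of_subset hsub huv,
      ae_restrict_mem measurableSet_Ioo] with x hx hxm
    have hca : c ∈ Icc a b := ⟨hac, hcd.le.trans hdb⟩
    have haa : a ∈ Icc a b := ⟨le_rfl, hac.trans (hcd.le.trans hdb)⟩
    have hxa : x ∈ Icc a b := ⟨hac.trans hxm.1.le, hxm.2.le.trans hdb⟩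
    have e1 : (∫ t in c..x, q.eval t) = Q₀.eval x - Q₀.eval c := by
      rw [intervalIntegral.integral_eq_sub_of_hasDerivAt (f := fun x => Q₀.eval x)]
      · intro t _
        have := Q₀.hasDerivAt t
        rwa [hQ₀'] at this
      · exact q.continuous.intervalIntegrable _ _
    have e2 : u x - (Q₀ + Polynomial.C (K + (∫ t in a..c, v t) - Q₀.eval c)).eval x
        = ∫ t in Ioo c x, w t := by
      rw [← integral_Ioc_eq_integral_Ioo, ← intervalIntegral.integral_of_le hxm.1.le, hw,
        intervalIntegral.integral_sub (hvI _ _ hca hxa) (q.continuous.intervalIntegrable _ _), e1,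
        ← intervalIntegral.integral_interval_sub_left (hvI _ _ haa hxa) (hvI _ _ haa hca), hx]
      simp
      ring
    have hsub' : Ioo c x ⊆ Ioo c d := Ioo_subset_Ioo_right hxm.2.le
    rw [e2]
    refine (sq_integral_le (hwL.mono_measure (Measure.restrict_mono hsub' le_rfl))).trans ?_
    rw [volume_real_Ioo_univ hxm.1.le]
    have : ∫ x in Ioo c x, w x ^ 2 ≤ B :=
      setIntegral_mono_set hwL.integrable_sq (Eventually.of_forall fun x => sq_nonneg _)
        hsub'.eventuallyLE
    have h1 : x - c ≤ d - c := by linarith [hxm.2]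
    have h2 : 0 ≤ d - c := by linarith
    have h3 : 0 ≤ ∫ x in Ioo c x, w x ^ 2 := integral_nonneg fun x => sq_nonneg _
    exact mul_le_mul h1 this h3 h2
  have := integral_mono_of_nonneg (Eventually.of_forall fun x => sq_nonneg _)
    (integrable_const ((d - c) * B)) hae
  refine this.trans (le_of_eq ?_)
  rw [integral_const, volume_real_Ioo_univ hcd.le, smul_eq_mul]
  ring

/-- Approximation by constants in terms of the Gagliardo seminorm. -/
theorem exists_const_approx_of_gagliardo {a b c d s : ℝ} (hs : 0 < s) (hac : a ≤ c) (hcd : c < d)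
    (hdb : d ≤ b) {g : ℝ → ℝ} (hg : MemLp g 2 (volume.restrict (Ioo a b)))
    (hfin : gagliardoSq a b s g < ⊤) :
    ∃ m : ℝ, ∫ x in Ioo c d, (g x - m) ^ 2 ≤ (d - c) ^ (2 * s) *
      ((volume.restrict (Ioo a b)).withDensity fun x => ∫⁻ y in Ioo a b,
        ENNReal.ofReal (|g x - g y| ^ 2 / |x - y| ^ (1 + 2 * s))).real (Ioo c d) := by
  have hsub : Ioo c d ⊆ Ioo a b := Ioo_subset_Ioo hac hdb
  -- The inner integral runs over all of `(a, b)`: the density is then independent of `(c, d)`, and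
  -- the bound is a measure of `(c, d)`.
  set w : ℝ → ENNReal := fun x => ∫⁻ y in Ioo a b,
        ENNReal.ofReal (|g x - g y| ^ 2 / |x - y| ^ (1 + 2 * s)) with hw
  have hgI : MemLp g 2 (volume.restrict (Ioo c d)) :=
    hg.mono_measure (Measure.restrict_mono hsub le_rfl)
  have hl : 0 < d - c := by linarith
  set m := (d - c)⁻¹ * ∫ y in Ioo c d, g y with hm
  refine ⟨m, ?_⟩
  have hlt : ∫⁻ x in Ioo c d, w x ≠ ⊤ :=
    ((lintegral_mono_set hsub).trans_lt hfin).ne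
  have hν : ((volume.restrict (Ioo a b)).withDensity w).real (Ioo c d)
      = (∫⁻ x in Ioo c d, w x).toReal := by
    rw [measureReal_def, withDensity_apply _ measurableSet_Ioo,
      Measure.restrict_restrict measurableSet_Ioo, inter_eq_self_of_subset_left hsub]
  rw [hν]
  -- The mean over `(c, d)` costs `(d - c)⁻¹`, and `|x - y| ≤ d - c` inserts the Gagliardo kernel at
  -- the price `(d - c) ^ (1 + 2 * s)`; the product is `(d - c) ^ (2 * s)`.
  have hpt : ∀ x ∈ Ioo c d, ENNReal.ofReal ((g x - m) ^ 2) ≤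
      ENNReal.ofReal ((d - c) ^ (2 * s)) * w x := by
    intro x hx
    have hgx : MemLp (fun y => g x - g y) 2 (volume.restrict (Ioo c d)) :=
      (memLp_const (g x)).sub hgI
    have e1 : g x - m = (d - c)⁻¹ * ∫ y in Ioo c d, (g x - g y) := by
      rw [integral_sub (integrable_const _) (hgI.integrable (by norm_num)), integral_const,
        volume_real_Ioo_univ hcd.le, hm, smul_eq_mul]
      field_simp
    have e2 : (g x - m) ^ 2 ≤ (d - c)⁻¹ * ∫ y in Ioo c d, (g x - g y) ^ 2 := by
      have := sq_integral_le hgx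
      rw [volume_real_Ioo_univ hcd.le] at this
      rw [e1, mul_pow]
      calc _ ≤ (d - c)⁻¹ ^ 2 * ((d - c) * ∫ y in Ioo c d, (g x - g y) ^ 2) := by gcongr
        _ = _ := by field_simp
    refine (ENNReal.ofReal_le_ofReal e2).trans ?_
    rw [ENNReal.ofReal_mul (by positivity), ofReal_integral_eq_lintegral_ofReal
      hgx.integrable_sq (Eventually.of_forall fun y => sq_nonneg _)]
    have e3 : ∀ y ∈ Ioo c d, ENNReal.ofReal ((g x - g y) ^ 2) ≤
        ENNReal.ofReal ((d - c) ^ (1 + 2 * s)) *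
          ENNReal.ofReal (|g x - g y| ^ 2 / |x - y| ^ (1 + 2 * s)) := by
      intro y hy
      rw [← ENNReal.ofReal_mul (by positivity)]
      apply ENNReal.ofReal_le_ofReal
      rcases eq_or_ne x y with rfl | hxy
      · simp
      · have h1 : 0 < |x - y| := abs_pos.2 (sub_ne_zero.2 hxy)
        have h2 : |x - y| ≤ d - c := by
          rw [abs_le]; constructor <;> linarith [hx.1, hx.2, hy.1, hy.2]
        have h3 : |x - y| ^ (1 + 2 * s) ≤ (d - c) ^ (1 + 2 * s) := by gcongr
        have h4 : 0 < |x - y| ^ (1 + 2 * s) := by positivity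
        rw [mul_div_assoc', le_div_iff₀ h4, sq_abs, mul_comm]
        gcongr
    calc ENNReal.ofReal (d - c)⁻¹ * ∫⁻ y in Ioo c d, ENNReal.ofReal ((g x - g y) ^ 2)
        ≤ ENNReal.ofReal (d - c)⁻¹ * ∫⁻ y in Ioo c d, (ENNReal.ofReal ((d - c) ^ (1 + 2 * s)) *
          ENNReal.ofReal (|g x - g y| ^ 2 / |x - y| ^ (1 + 2 * s))) := by
          exact mul_le_mul_right (setLIntegral_mono' measurableSet_Ioo e3) _
      _ = ENNReal.ofReal (d - c)⁻¹ * (ENNReal.ofReal ((d - c) ^ (1 + 2 * s)) *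
          ∫⁻ y in Ioo c d, ENNReal.ofReal (|g x - g y| ^ 2 / |x - y| ^ (1 + 2 * s))) := by
          rw [lintegral_const_mul' _ _ ENNReal.ofReal_ne_top]
      _ ≤ ENNReal.ofReal (d - c)⁻¹ * (ENNReal.ofReal ((d - c) ^ (1 + 2 * s)) * w x) := by
          gcongr
          exact lintegral_mono_set hsub
      _ = ENNReal.ofReal ((d - c) ^ (2 * s)) * w x := by
          rw [← mul_assoc, ← ENNReal.ofReal_mul (by positivity), Real.rpow_add hl, Real.rpow_one]
          congr 2
          field_simp
  have hint : Integrable (fun x => (g x - m) ^ 2) (volume.restrict (Ioo c d)) :=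
    (hgI.sub (memLp_const m)).integrable_sq
  have key : ENNReal.ofReal (∫ x in Ioo c d, (g x - m) ^ 2) ≤
      ENNReal.ofReal ((d - c) ^ (2 * s)) * ∫⁻ x in Ioo c d, w x := by
    rw [ofReal_integral_eq_lintegral_ofReal hint (Eventually.of_forall fun y => sq_nonneg _),
      ← lintegral_const_mul' _ _ ENNReal.ofReal_ne_top]
    exact setLIntegral_mono' measurableSet_Ioo hpt
  have := ENNReal.toReal_mono (ENNReal.mul_ne_top ENNReal.ofReal_ne_top hlt) key
  rwa [ENNReal.toReal_mul, ENNReal.toReal_ofReal (integral_nonneg fun x => sq_nonneg _),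
    ENNReal.toReal_ofReal (by positivity)] at this


theorem MeasureTheory.MemLp.restrict_Ioo {a b c d : ℝ} {f : ℝ → ℝ} (hf : MemLp f 2 (volume.restrict (Ioo a b)))
    (hac : a ≤ c) (hdb : d ≤ b) : MemLp f 2 (volume.restrict (Ioo c d)) :=
  hf.mono_measure (Measure.restrict_mono (Ioo_subset_Ioo hac hdb) le_rfl)

theorem integral_sq_le_two_mul {X : Type*} [MeasurableSpace X] {μ : Measure X} {f g : X → ℝ}
    (hf : MemLp f 2 μ) (hg : MemLp g 2 μ) :
    ∫ x, f x ^ 2 ∂μ ≤ 2 * ∫ x, (f x - g x) ^ 2 ∂μ + 2 * ∫ x, g x ^ 2 ∂μ := by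
  rw [← integral_const_mul, ← integral_const_mul, ← integral_add
    (f := fun x => 2 * (f x - g x) ^ 2)
    ((hf.sub hg).integrable_sq.const_mul 2) (hg.integrable_sq.const_mul 2)]
  refine integral_mono hf.integrable_sq
    (((hf.sub hg).integrable_sq.const_mul 2).add (hg.integrable_sq.const_mul 2)) fun x => ?_
  change f x ^ 2 ≤ 2 * (f x - g x) ^ 2 + 2 * g x ^ 2
  nlinarith [sq_nonneg (f x - 2 * g x)]

theorem withDensity_sq_real {a b c d : ℝ} {g : ℝ → ℝ}
    (hg : MemLp g 2 (volume.restrict (Ioo a b))) (hac : a ≤ c) (hdb : d ≤ b) :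
    ((volume.restrict (Ioo a b)).withDensity fun x => ENNReal.ofReal (g x ^ 2)).real (Ioo c d) =
      ∫ x in Ioo c d, g x ^ 2 := by
  have hsub : Ioo c d ⊆ Ioo a b := Ioo_subset_Ioo hac hdb
  rw [measureReal_def, withDensity_apply _ measurableSet_Ioo,
    Measure.restrict_restrict measurableSet_Ioo, inter_eq_self_of_subset_left hsub,
    ← ofReal_integral_eq_lintegral_ofReal (hg.restrict_Ioo hac hdb).integrable_sq
      (Eventually.of_forall fun x => sq_nonneg _),
    ENNReal.toReal_ofReal (integral_nonneg fun x => sq_nonneg _)]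

theorem natFloor_add_fract {α : ℝ} (hα : 0 ≤ α) : (⌊α⌋₊ : ℝ) + Int.fract α = α := by
  rw [natCast_floor_eq_intCast_floor hα, Int.floor_add_fract]

/-- Repeated integration turns an approximation of the top weak derivative by a constant into one of
`f` by a polynomial, each of the `⌊α⌋₊` steps gaining `(d - c) ^ 2`. The bound involves a measure so
that a sum over disjoint intervals costs only the total mass. -/
theorem MemSobolev.exists_poly_approx {α a b : ℝ} {f : ℝ → ℝ} (hα : 0 ≤ α) (hab : a < b)
    (hf : MemSobolev α a b f) : ∃ ν : Measure ℝ, IsFiniteMeasure ν ∧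
      ∀ c d, a ≤ c → c < d → d ≤ b → ∃ q : Polynomial ℝ, q.natDegree ≤ ⌊α⌋₊ ∧
        ∫ x in Ioo c d, (f x - q.eval x) ^ 2 ≤ (d - c) ^ (2 * α) * ν.real (Ioo c d) := by
  obtain ⟨hf2, g, hg, hgag⟩ := hf
  set k := ⌊α⌋₊ with hk
  set s := Int.fract α with hs
  have hint : ∀ j ≤ k, IntegrableOn (g j) (Ioo a b) := fun j hj =>
    (hg j hj).1.integrable (by norm_num)
  have hf0 : f =ᵐ[volume.restrict (Ioo a b)] g 0 :=
    (hg 0 (Nat.zero_le _)).2.ae_eq (hf2.integrable (by norm_num)) (hint 0 (Nat.zero_le _))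
  have hchain : ∀ j, j + 1 ≤ k →
      ∃ K, ∀ᵐ x ∂(volume.restrict (Ioo a b)), g j x = K + ∫ t in a..x, g (j + 1) t := by
    intro j hj
    exact ((hg j (by omega)).2.succ (hg (j + 1) hj).2).exists_primitive hab
      (hint j (by omega)) (hint _ hj)
  have hbase : ∃ ν : Measure ℝ, IsFiniteMeasure ν ∧ ∀ c d, a ≤ c → c < d → d ≤ b → ∃ m : ℝ,
      ∫ x in Ioo c d, (g k x - m) ^ 2 ≤ (d - c) ^ (2 * s) * ν.real (Ioo c d) := by
    rcases (Int.fract_nonneg α).eq_or_lt with h0 | hpos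
    -- For integer `α` the constant `0` suffices, and `ν` has density `(g k)²`.
    · have hgk := (hg k le_rfl).1.integrable_sq
      refine ⟨(volume.restrict (Ioo a b)).withDensity fun x => ENNReal.ofReal (g k x ^ 2),
        isFiniteMeasure_withDensity_ofReal hgk.2, fun c d hac hcd hdb => ⟨0, ?_⟩⟩
      rw [hs, ← h0, mul_zero, Real.rpow_zero, one_mul, withDensity_sq_real (hg k le_rfl).1 hac hdb]
      simp
    · refine ⟨_, ?_, fun c d hac hcd hdb =>
        exists_const_approx_of_gagliardo hpos hac hcd hdb (hg k le_rfl).1 (hgag hpos)⟩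
      exact isFiniteMeasure_withDensity (hgag hpos).ne
  obtain ⟨ν, hν, hbase⟩ := hbase
  refine ⟨ν, hν, fun c d hac hcd hdb => ?_⟩
  have hl : 0 < d - c := by linarith
  have step : ∀ i ≤ k, ∃ q : Polynomial ℝ, q.natDegree ≤ i ∧
      ∫ x in Ioo c d, (g (k - i) x - q.eval x) ^ 2 ≤
        (d - c) ^ (2 * (i + s)) * ν.real (Ioo c d) := by
    intro i
    induction i with
    | zero =>
      intro _
      obtain ⟨m, hm⟩ := hbase c d hac hcd hdb
      exact ⟨Polynomial.C m, by simp, by simpa using hm⟩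
    | succ i ih =>
      intro hi
      obtain ⟨q, hq, hq'⟩ := ih (by omega)
      obtain ⟨K, hK⟩ := hchain (k - (i + 1)) (by omega)
      have e : k - (i + 1) + 1 = k - i := by omega
      rw [e] at hK
      obtain ⟨Q, hQ, -, hQ'⟩ := exists_poly_approx_of_primitive hac hcd hdb
        (hg (k - i) (by omega)).1 hK hq
      refine ⟨Q, hQ, hQ'.trans ?_⟩
      have e2 : (d - c) ^ (2 * (((i + 1 : ℕ) : ℝ) + s)) =
          (d - c) ^ 2 * (d - c) ^ (2 * ((i : ℝ) + s)) := by
        rw [← Real.rpow_natCast (d - c) 2, ← Real.rpow_add hl]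
        congr 1; push_cast; ring
      rw [e2, mul_assoc]
      gcongr
  obtain ⟨q, hq, hq'⟩ := step k le_rfl
  refine ⟨q, hq, ?_⟩
  rw [hk, hs, natFloor_add_fract hα, ← hk, Nat.sub_self] at hq'
  refine le_trans (le_of_eq (integral_congr_ae ?_)) hq'
  filter_upwards [ae_restrict_of_ae_restrict_of_subset (Ioo_subset_Ioo hac hdb) hf0] with x hx
  rw [hx]

theorem MemSobolev.one_of_one_le {α a b : ℝ} {f : ℝ → ℝ} (hα : 1 ≤ α) (hf : MemSobolev α a b f) :
    MemSobolev 1 a b f := by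
  obtain ⟨hf2, g, hg, -⟩ := hf
  refine ⟨hf2, g, fun j hj => hg j ?_, fun h => ?_⟩
  · rw [Nat.floor_one] at hj
    exact hj.trans (Nat.le_floor (by simpa using hα))
  · simp at h

/-- A function in `W^{1,2}` is essentially bounded. -/
theorem MemSobolev.exists_ae_bound {a b : ℝ} {f : ℝ → ℝ} (hab : a < b) (hf : MemSobolev 1 a b f) :
    ∃ B, ∀ᵐ x ∂(volume.restrict (Ioo a b)), |f x| ≤ B := by
  obtain ⟨hf2, g, hg, -⟩ := hf
  rw [Nat.floor_one] at hg
  have hf1 : IntegrableOn f (Ioo a b) := hf2.integrable (by norm_num)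
  have h0 : IntegrableOn (g 0) (Ioo a b) := (hg 0 (by simp)).1.integrable (by norm_num)
  have h1 : IntegrableOn (g 1) (Ioo a b) := (hg 1 le_rfl).1.integrable (by norm_num)
  have hf0 := (hg 0 (by simp)).2.ae_eq hf1 h0
  obtain ⟨K, hK⟩ := ((hg 0 (by simp)).2.succ (hg 1 le_rfl).2).exists_primitive hab h0 h1
  refine ⟨|K| + ∫ t in Ioo a b, |g 1 t|, ?_⟩
  filter_upwards [hf0, hK, ae_restrict_mem measurableSet_Ioo] with x hx hx' hxm
  rw [hx, hx']
  refine (abs_add_le _ _).trans (add_le_add le_rfl ?_)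
  rw [intervalIntegral.integral_of_le hxm.1.le, integral_Ioc_eq_integral_Ioo]
  refine (abs_integral_le_integral_abs).trans ?_
  exact setIntegral_mono_set h1.abs (Eventually.of_forall fun x => abs_nonneg _)
    (Ioo_subset_Ioo_right hxm.2.le).eventuallyLE

/-- The mass of `f ^ 2` on short intervals. -/
theorem MemSobolev.exists_integral_sq_le {α a b : ℝ} {f : ℝ → ℝ} (hα : 0 < α) (hab : a < b)
    (hf : MemSobolev α a b f) : ∃ C, 0 ≤ C ∧ ∀ c d, a ≤ c → c < d → d ≤ b →
      ∫ x in Ioo c d, f x ^ 2 ≤ C * (d - c) ^ (2 * α / (2 * α + 1)) := by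
  set r := 2 * α / (2 * α + 1) with hr
  have hr0 : 0 < r := by positivity
  have hr1 : r < 1 := by rw [hr, div_lt_one (by positivity)]; linarith
  have hL : 0 < b - a := by linarith
  rcases le_or_gt 1 α with h1 | h1
  · obtain ⟨B, hB⟩ := (hf.one_of_one_le h1).exists_ae_bound hab
    refine ⟨B ^ 2 * (b - a) ^ (1 - r), by positivity, fun c d hac hcd hdb => ?_⟩
    have hl : 0 < d - c := by linarith
    have hae : ∀ᵐ x ∂(volume.restrict (Ioo c d)), f x ^ 2 ≤ B ^ 2 := by
      filter_upwards [ae_restrict_of_ae_restrict_of_subset (Ioo_subset_Ioo hac hdb) hB] with x hx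
      exact sq_le_sq' (neg_le_of_abs_le hx) (le_of_abs_le hx)
    have := integral_mono_of_nonneg (Eventually.of_forall fun x => sq_nonneg _)
      (integrable_const (B ^ 2)) hae
    rw [integral_const, volume_real_Ioo_univ hcd.le, smul_eq_mul] at this
    refine this.trans ?_
    have e : d - c = (d - c) ^ (1 - r) * (d - c) ^ r := by
      rw [← Real.rpow_add hl]; simp
    have e2 : (d - c) ^ (1 - r) ≤ (b - a) ^ (1 - r) :=
      Real.rpow_le_rpow hl.le (by linarith) (by linarith)
    calc (d - c) * B ^ 2 = B ^ 2 * (d - c) ^ (1 - r) * (d - c) ^ r := by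
          rw [mul_assoc, ← e, mul_comm]
      _ ≤ _ := by gcongr
  · have hf2 := hf.1
    obtain ⟨ν, hν, hq⟩ := hf.exists_poly_approx hα.le hab
    rw [Nat.floor_eq_zero.2 h1] at hq
    set F := ∫ x in Ioo a b, f x ^ 2 with hF
    set N := ν.real univ with hN
    have hF0 : 0 ≤ F := integral_nonneg fun x => sq_nonneg _
    have hN0 : 0 ≤ N := measureReal_nonneg
    have hFle : ∀ c d, a ≤ c → d ≤ b → ∫ x in Ioo c d, f x ^ 2 ≤ F := fun c d hac hdb =>
      setIntegral_mono_set hf2.integrable_sq (Eventually.of_forall fun x => sq_nonneg _)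
        (Ioo_subset_Ioo hac hdb).eventuallyLE
    refine ⟨6 * N + 4 * F + F + F / (b - a) ^ (2 * α), by positivity, fun c d hac hcd hdb => ?_⟩
    set h := d - c with hh
    have hl : 0 < h := by linarith
    -- For `α < 1`, `f` is compared with a constant `m` on a longer interval of length `H` around
    -- `(c, d)`. There `f - m` has squared norm `O(H ^ (2 α))`, while `H m²` is bounded, so `h m² =
    -- O(h / H)`. The choice of `H` makes `h / H = H ^ (2 α) = h ^ r`.
    set H := h ^ (1 / (2 * α + 1)) with hH
    have hH0 : 0 < H := by positivity
    have hHr : H ^ (2 * α) = h ^ r := by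
      rw [hH, ← Real.rpow_mul hl.le, hr]; congr 1; ring
    have hhH : h = H * H ^ (2 * α) := by
      rw [← Real.rpow_one_add' hH0.le (by positivity), hH, ← Real.rpow_mul hl.le]
      rw [show 1 / (2 * α + 1) * (1 + 2 * α) = 1 by field_simp; ring, Real.rpow_one]
    rw [← hHr]
    have hX : 0 < H ^ (2 * α) := by positivity
    -- If `H ≥ b - a` or `h > 1`, the power `H ^ (2 α)` is bounded below and the total mass `F` is a
    -- sufficient bound.
    rcases le_or_gt (b - a) H with hc1 | hc1
    · have e1 : (b - a) ^ (2 * α) ≤ H ^ (2 * α) := Real.rpow_le_rpow hL.le hc1 (by positivity)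
      calc ∫ x in Ioo c d, f x ^ 2 ≤ F := hFle c d hac hdb
        _ = F / (b - a) ^ (2 * α) * (b - a) ^ (2 * α) := by field_simp
        _ ≤ F / (b - a) ^ (2 * α) * H ^ (2 * α) := by gcongr
        _ ≤ _ := by
          gcongr
          have : 0 ≤ 6 * N + 4 * F + F := by positivity
          linarith
    rcases le_or_gt h 1 with hc2 | hc2
    swap
    · have e1 : 1 ≤ H ^ (2 * α) := by
        rw [hHr]; exact Real.one_le_rpow hc2.le hr0.le
      have e2 : 0 ≤ F / (b - a) ^ (2 * α) := by positivity
      calc ∫ x in Ioo c d, f x ^ 2 ≤ F := hFle c d hac hdb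
        _ = F * 1 := by ring
        _ ≤ (6 * N + 4 * F + F + F / (b - a) ^ (2 * α)) * H ^ (2 * α) := by
          gcongr
          linarith
    have hhle : h ≤ H := by
      rw [hH]
      nth_rewrite 1 [← Real.rpow_one h]
      apply Real.rpow_le_rpow_of_exponent_ge hl hc2
      rw [div_le_one (by positivity)]; linarith
    -- An interval of length `H` ending at `d`, pushed to the right if it would leave `(a, b)`.
    set c' := max a (d - H) with hc'
    have ha' : a ≤ c' := le_max_left _ _
    have hcc' : c' ≤ c := max_le hac (by linarith)
    have hdd' : d ≤ c' + H := by have := le_max_right a (d - H); linarith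
    have hdb' : c' + H ≤ b := by
      rw [hc', ← max_add_add_right]; apply max_le <;> linarith
    obtain ⟨q, hq0, hq1⟩ := hq c' (c' + H) ha' (by linarith) hdb'
    obtain ⟨m, rfl⟩ : ∃ m, q = Polynomial.C m :=
      ⟨_, Polynomial.eq_C_of_natDegree_le_zero hq0⟩
    simp only [Polynomial.eval_C, add_sub_cancel_left] at hq1
    have hνle : ν.real (Ioo c' (c' + H)) ≤ N := measureReal_mono (subset_univ _)
    have hfI := hf2.restrict_Ioo ha' hdb'
    have hfI' := hf2.restrict_Ioo hac hdb
    have q1 : ∫ x in Ioo c' (c' + H), (f x - m) ^ 2 ≤ H ^ (2 * α) * N :=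
      hq1.trans (by gcongr)
    have q2 : H * m ^ 2 ≤ 2 * (H ^ (2 * α) * N) + 2 * F := by
      have := integral_sq_le_two_mul (f := fun _ => m) (g := f) (memLp_const _) hfI
      rw [integral_const, volume_real_Ioo_univ (by linarith), smul_eq_mul,
        add_sub_cancel_left] at this
      simp only [sub_sq_comm m] at this
      linarith [hFle c' (c' + H) ha' hdb']
    have q3 : ∫ x in Ioo c d, (f x - m) ^ 2 ≤ H ^ (2 * α) * N :=
      (setIntegral_mono_set (hfI.sub (memLp_const m)).integrable_sq
        (Eventually.of_forall fun x => sq_nonneg _)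
        (Ioo_subset_Ioo hcc' hdd').eventuallyLE).trans q1
    have q4 := integral_sq_le_two_mul (f := f) (g := fun _ => m) hfI' (memLp_const _)
    rw [integral_const (μ := volume.restrict (Ioo c d)), volume_real_Ioo_univ hcd.le,
      smul_eq_mul, ← hh] at q4
    have hX1 : H ^ (2 * α) ≤ 1 := by
      rw [hHr]; exact Real.rpow_le_one hl.le hc2 hr0.le
    have q5 : h * m ^ 2 ≤ H ^ (2 * α) * (2 * N + 2 * F) := by
      calc h * m ^ 2 = H ^ (2 * α) * (H * m ^ 2) := by
            conv_lhs => rw [hhH]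
            ring
        _ ≤ H ^ (2 * α) * (2 * (1 * N) + 2 * F) := by
            have : H ^ (2 * α) * N ≤ 1 * N := by gcongr
            exact mul_le_mul_of_nonneg_left (by linarith) hX.le
        _ = _ := by ring
    calc ∫ x in Ioo c d, f x ^ 2 ≤ (6 * N + 4 * F) * H ^ (2 * α) := by linarith
      _ ≤ _ := by
        refine mul_le_mul_of_nonneg_right ?_ hX.le
        have : 0 ≤ F / (b - a) ^ (2 * α) := by positivity
        linarith

/-- Approximation by constants on subintervals. -/
theorem MemSobolev.exists_const_approx {α a b : ℝ} {f : ℝ → ℝ} (hα : 0 ≤ α) (hab : a < b)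
    (hf : MemSobolev α a b f) : ∃ ν : Measure ℝ, IsFiniteMeasure ν ∧
      ∀ c d, a ≤ c → c < d → d ≤ b → ∃ m : ℝ,
        ∫ x in Ioo c d, (f x - m) ^ 2 ≤ (d - c) ^ (2 * min α 1) * ν.real (Ioo c d) := by
  rcases lt_or_ge α 1 with h1 | h1
  · obtain ⟨ν, hν, h⟩ := hf.exists_poly_approx hα hab
    refine ⟨ν, hν, fun c d hac hcd hdb => ?_⟩
    obtain ⟨q, hq, hq'⟩ := h c d hac hcd hdb
    rw [Nat.floor_eq_zero.2 h1] at hq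
    obtain ⟨m, rfl⟩ : ∃ m, q = Polynomial.C m := ⟨_, Polynomial.eq_C_of_natDegree_le_zero hq⟩
    exact ⟨m, by simpa [min_eq_left h1.le] using hq'⟩
  · obtain ⟨hf2, g, hg, -⟩ := hf.one_of_one_le h1
    rw [Nat.floor_one] at hg
    have h0 : IntegrableOn (g 0) (Ioo a b) := (hg 0 (by simp)).1.integrable (by norm_num)
    have hf0 := (hg 0 (by simp)).2.ae_eq (hf2.integrable (by norm_num)) h0
    have hg1 := (hg 1 le_rfl).1
    obtain ⟨K, hK⟩ := ((hg 0 (by simp)).2.succ (hg 1 le_rfl).2).exists_primitive hab h0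
      (hg1.integrable (by norm_num))
    refine ⟨(volume.restrict (Ioo a b)).withDensity fun x => ENNReal.ofReal (g 1 x ^ 2),
      isFiniteMeasure_withDensity_ofReal hg1.integrable_sq.2, fun c d hac hcd hdb => ?_⟩
    -- Integrating the zero polynomial yields a polynomial with zero derivative, hence a constant.
    obtain ⟨Q, -, hQ, hQ'⟩ := exists_poly_approx_of_primitive hac hcd hdb hg1 hK
      (q := 0) (e := 0) (by simp)
    obtain ⟨m, rfl⟩ : ∃ m, Q = Polynomial.C m :=
      ⟨_, Polynomial.eq_C_of_natDegree_eq_zero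
        (Polynomial.derivative_eq_zero.1 hQ)⟩
    refine ⟨m, ?_⟩
    rw [withDensity_sq_real hg1 hac hdb, min_eq_right h1, mul_one, Real.rpow_two]
    simp only [Polynomial.eval_C, Polynomial.eval_zero, sub_zero] at hQ'
    refine le_trans (le_of_eq (integral_congr_ae ?_)) hQ'
    filter_upwards [ae_restrict_of_ae_restrict_of_subset (Ioo_subset_Ioo hac hdb) hf0] with x hx
    rw [hx]


/-! ### Piecewise Sobolev functions -/

section pieces

variable {N : ℕ} {x : Fin (N + 1) → ℝ}

theorem exists_piece (h0 : x 0 = 0) (h1 : x (Fin.last N) = 1) {c : ℝ} (hc : 0 ≤ c) (hc1 : c < 1) :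
    ∃ i : Fin N, x i.castSucc ≤ c ∧ c < x i.succ := by
  by_contra! hcon
  have : ∀ j, x j ≤ c := fun j => by
    induction j using Fin.induction with
    | zero => rw [h0]; exact hc
    | succ i ih => exact hcon i ih
  have := this (Fin.last N)
  rw [h1] at this
  linarith

theorem pairwise_disjoint_pieces (hx : StrictMono x) (c d : ℝ) :
    Pairwise (Function.onFun Disjoint
      fun i : Fin N => Ioo (max c (x i.castSucc)) (min d (x i.succ))) := by
  have key : ∀ i j : Fin N, i < j → Disjoint (Ioo (max c (x i.castSucc)) (min d (x i.succ)))
      (Ioo (max c (x j.castSucc)) (min d (x j.succ))) := by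
    intro i j hij
    rw [Set.disjoint_left]
    intro t ht ht'
    have h1 : t < x i.succ := (lt_min_iff.1 ht.2).2
    have h2 : x j.castSucc < t := (max_lt_iff.1 ht'.1).2
    have h3 : x i.succ ≤ x j.castSucc := hx.monotone (by
      rw [Fin.le_def]; simpa using hij)
    linarith
  intro i j hij
  rcases lt_or_gt_of_ne hij with h | h
  · exact key i j h
  · exact (key j i h).symm

theorem Ioo_ae_eq_iUnion_pieces (h0 : x 0 = 0) (h1 : x (Fin.last N) = 1) {c d : ℝ}
    (hc : 0 ≤ c) (hd : d ≤ 1) :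
    (Ioo c d : Set ℝ) =ᵐ[volume]
      ⋃ i : Fin N, Ioo (max c (x i.castSucc)) (min d (x i.succ)) := by
  rw [ae_eq_set]
  constructor
  · refine measure_mono_null (t := range x) ?_ ((finite_range x).measure_zero _)
    rintro t ⟨ht, ht'⟩
    by_contra hr
    obtain ⟨i, hi, hi'⟩ := exists_piece h0 h1 (hc.trans ht.1.le) (ht.2.trans_le hd)
    refine ht' (mem_iUnion.2 ⟨i, max_lt ht.1 (lt_of_le_of_ne hi ?_), lt_min ht.2 hi'⟩)
    exact fun h => hr ⟨_, h⟩
  · rw [sdiff_eq_empty.2, measure_empty]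
    exact iUnion_subset fun i => Ioo_subset_Ioo (le_max_left _ _) (min_le_left _ _)

theorem memLp_of_pieces (h0 : x 0 = 0) (h1 : x (Fin.last N) = 1) {f : ℝ → ℝ}
    (hf : ∀ i : Fin N, MemLp f 2 (volume.restrict (Ioo (x i.castSucc) (x i.succ)))) :
    MemLp f 2 (volume.restrict (Ioo 0 1)) := by
  rw [Measure.restrict_congr_set (Ioo_ae_eq_iUnion_pieces h0 h1 le_rfl le_rfl)]
  have hf' : ∀ i : Fin N, MemLp f 2
      (volume.restrict (Ioo (max 0 (x i.castSucc)) (min 1 (x i.succ)))) := fun i =>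
    (hf i).restrict_Ioo (le_max_right _ _) (min_le_right _ _)
  have hm : AEStronglyMeasurable f (volume.restrict
      (⋃ i : Fin N, Ioo (max 0 (x i.castSucc)) (min 1 (x i.succ)))) :=
    aestronglyMeasurable_iUnion_iff.2 fun i => (hf' i).1
  rw [memLp_two_iff_integrable_sq hm]
  exact integrableOn_finite_iUnion.2 fun i => (hf' i).integrable_sq

theorem integral_sq_pieces (hx : StrictMono x) (h0 : x 0 = 0) (h1 : x (Fin.last N) = 1)
    {f : ℝ → ℝ} (hf : ∀ i : Fin N, MemLp f 2 (volume.restrict (Ioo (x i.castSucc) (x i.succ))))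
    {c d : ℝ} (hc : 0 ≤ c) (hd : d ≤ 1) :
    ∫ t in Ioo c d, f t ^ 2 =
      ∑ i : Fin N, ∫ t in Ioo (max c (x i.castSucc)) (min d (x i.succ)), f t ^ 2 := by
  rw [setIntegral_congr_set (Ioo_ae_eq_iUnion_pieces h0 h1 hc hd),
    integral_iUnion_fintype (fun i => measurableSet_Ioo) (pairwise_disjoint_pieces hx c d)]
  exact fun i => ((hf i).restrict_Ioo (le_max_right _ _) (min_le_right _ _)).integrable_sq

end pieces

/-- Gluing interval estimates on the pieces. -/
theorem glue_pieces {N : ℕ} {x : Fin (N + 1) → ℝ} (h0 : x 0 = 0) (h1 : x (Fin.last N) = 1)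
    {E : ℝ → ℝ → ℝ → Prop} (hE : ∀ c d s t, c < d → s ≤ t → E c d s → E c d t)
    (h : ∀ i : Fin N, ∃ ν : Measure ℝ, IsFiniteMeasure ν ∧
      ∀ c d, x i.castSucc ≤ c → c < d → d ≤ x i.succ → E c d (ν.real (Ioo c d))) :
    ∃ ν : Measure ℝ, IsFiniteMeasure ν ∧ ∀ c d, 0 ≤ c → c < d → d ≤ 1 →
      (∀ t ∈ range x, t ∉ Ioo c d) → E c d (ν.real (Ioo c d)) := by
  choose ν hν hνE using h
  refine ⟨∑ i, ν i, inferInstance, fun c d hc hcd hd hgood => ?_⟩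
  obtain ⟨i, hi, hi'⟩ := exists_piece h0 h1 hc (hcd.trans_le hd)
  have hi2 : d ≤ x i.succ := by
    by_contra! hlt
    exact hgood _ ⟨_, rfl⟩ ⟨hi', hlt⟩
  refine hE _ _ _ _ hcd ?_ (hνE i c d hi hcd hi2)
  rw [measureReal_def, measureReal_def]
  refine ENNReal.toReal_mono (measure_ne_top _ _) ?_
  rw [Measure.finsetSum_apply]
  exact Finset.single_le_sum (f := fun i => (ν i) (Ioo c d)) (fun _ _ => by positivity) (Finset.mem_univ i)

/-- The properties of piecewise Sobolev functions that determine the rate. -/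
theorem PiecewiseSobolev.exists_estimates {α : ℝ} {J : ℕ} {f : ℝ → ℝ} (hα : 0 < α)
    (hf : PiecewiseSobolev α J f) : MemLp f 2 (volume.restrict (Ioo 0 1)) ∧
    ∃ S : Finset ℝ, (∀ t ∈ S, 0 ≤ t) ∧
      (∃ ν : Measure ℝ, IsFiniteMeasure ν ∧ ∀ c d, 0 ≤ c → c < d → d ≤ 1 →
        (∀ t ∈ S, t ∉ Ioo c d) → ∃ q : Polynomial ℝ, q.natDegree ≤ ⌊α⌋₊ ∧
          ∫ x in Ioo c d, (f x - q.eval x) ^ 2 ≤ (d - c) ^ (2 * α) * ν.real (Ioo c d)) ∧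
      (∃ ν : Measure ℝ, IsFiniteMeasure ν ∧ ∀ c d, 0 ≤ c → c < d → d ≤ 1 →
        (∀ t ∈ S, t ∉ Ioo c d) → ∃ m : ℝ,
          ∫ x in Ioo c d, (f x - m) ^ 2 ≤ (d - c) ^ (2 * min α 1) * ν.real (Ioo c d)) ∧
      ∃ C, 0 ≤ C ∧ ∀ c d, 0 ≤ c → c < d → d ≤ 1 →
        ∫ x in Ioo c d, f x ^ 2 ≤ C * (d - c) ^ (2 * α / (2 * α + 1)) := by
  obtain ⟨x, hx, h0, h1, hS⟩ := hf
  have hlt : ∀ i : Fin (J + 1), x i.castSucc < x i.succ := fun i => hx Fin.castSucc_lt_succ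
  refine ⟨memLp_of_pieces h0 h1 fun i => (hS i).1, Finset.univ.image x, ?_, ?_, ?_, ?_⟩
  · intro t ht
    obtain ⟨i, -, rfl⟩ := Finset.mem_image.1 ht
    rw [← h0]; exact hx.monotone (Fin.zero_le _)
  · simp only [Finset.mem_image, Finset.mem_univ, true_and]
    refine glue_pieces (E := fun c d s => ∃ q : Polynomial ℝ, q.natDegree ≤ ⌊α⌋₊ ∧
      ∫ x in Ioo c d, (f x - q.eval x) ^ 2 ≤ (d - c) ^ (2 * α) * s) h0 h1 ?_
      fun i => (hS i).exists_poly_approx hα.le (hlt i)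
    rintro c d s t hcd hst ⟨q, hq, hq'⟩
    have : 0 ≤ d - c := by linarith
    exact ⟨q, hq, hq'.trans (by gcongr)⟩
  · simp only [Finset.mem_image, Finset.mem_univ, true_and]
    refine glue_pieces (E := fun c d s => ∃ m : ℝ,
      ∫ x in Ioo c d, (f x - m) ^ 2 ≤ (d - c) ^ (2 * min α 1) * s) h0 h1 ?_
      fun i => (hS i).exists_const_approx hα.le (hlt i)
    rintro c d s t hcd hst ⟨m, hm⟩
    have : 0 ≤ d - c := by linarith
    exact ⟨m, hm.trans (by gcongr)⟩
  · choose C hC0 hC using fun i => (hS i).exists_integral_sq_le hα (hlt i)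
    refine ⟨∑ i, C i, Finset.sum_nonneg fun i _ => hC0 i, fun c d hc hcd hd => ?_⟩
    rw [integral_sq_pieces hx h0 h1 (fun i => (hS i).1) hc hd, Finset.sum_mul]
    refine Finset.sum_le_sum fun i _ => ?_
    rcases lt_or_ge (max c (x i.castSucc)) (min d (x i.succ)) with hlt' | hge
    · refine (hC i _ _ (le_max_right _ _) hlt' (min_le_right _ _)).trans ?_
      have h2 : 0 ≤ min d (x i.succ) - max c (x i.castSucc) := by linarith
      have h3 : min d (x i.succ) - max c (x i.castSucc) ≤ d - c :=
        sub_le_sub (min_le_left _ _) (le_max_left _ _)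
      have := hC0 i
      gcongr
    · rw [Ioo_eq_empty (not_lt.2 hge)]
      simp only [Measure.restrict_empty, integral_zero_measure]
      have := hC0 i
      have : 0 ≤ d - c := by linarith
      positivity


/-! ### Grid cells and means -/

section grid

variable {n : ℕ}

theorem mem_gridCell (hn : 0 < n) {s : Fin n} {x : ℝ} :
    x ∈ gridCell n s ↔ (s : ℝ) ≤ n * x ∧ n * x < s + 1 := by
  have : (0 : ℝ) < n := by exact_mod_cast hn
  rw [gridCell, mem_Ico, div_le_iff₀ this, lt_div_iff₀ this, mul_comm]

theorem measurableSet_gridCell (s : Fin n) : MeasurableSet (gridCell n s) := measurableSet_Ico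

theorem gridCell_eq_of_mem (hn : 0 < n) {s t : Fin n} {x : ℝ} (hs : x ∈ gridCell n s)
    (ht : x ∈ gridCell n t) : s = t := by
  rw [mem_gridCell hn] at hs ht
  have h1 : (s : ℝ) < t + 1 := by linarith
  have h2 : (t : ℝ) < s + 1 := by linarith
  have h1' : (s : ℕ) < t + 1 := by exact_mod_cast h1
  have h2' : (t : ℕ) < s + 1 := by exact_mod_cast h2
  apply Fin.ext; omega

theorem disjoint_gridCell (hn : 0 < n) :
    Pairwise (Function.onFun Disjoint (gridCell n)) := by
  intro s t hst
  rw [Function.onFun, Set.disjoint_left]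
  exact fun x hx hx' => hst (gridCell_eq_of_mem hn hx hx')

theorem iUnion_gridCell_Icc (hn : 0 < n) {i j : Fin n} :
    ⋃ s ∈ Finset.Icc i j, gridCell n s = Ico ((i : ℝ) / n) (((j : ℝ) + 1) / n) := by
  have hn' : (0 : ℝ) < n := by exact_mod_cast hn
  ext x
  simp only [mem_iUnion, Finset.mem_Icc, exists_prop, mem_gridCell hn, mem_Ico,
    div_le_iff₀ hn', lt_div_iff₀ hn', mul_comm x]
  constructor
  · rintro ⟨s, ⟨h1, h2⟩, h3, h4⟩
    have h1' : (i : ℝ) ≤ s := by exact_mod_cast h1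
    have h2' : (s : ℝ) ≤ j := by exact_mod_cast h2
    constructor <;> linarith
  · rintro ⟨h1, h2⟩
    have h0 : (0 : ℝ) ≤ n * x := le_trans (by positivity) h1
    have h3 : (i : ℕ) ≤ ⌊(n : ℝ) * x⌋₊ := Nat.le_floor h1
    have h4 : ⌊(n : ℝ) * x⌋₊ < j + 1 := by
      rw [Nat.floor_lt h0]; exact_mod_cast h2
    refine ⟨⟨⌊(n : ℝ) * x⌋₊, by omega⟩, ⟨h3, Nat.lt_succ_iff.1 h4⟩, Nat.floor_le h0,
      Nat.lt_floor_add_one _⟩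

theorem iUnion_gridCell (hn : 0 < n) : ⋃ s, gridCell n s = Ico (0 : ℝ) 1 := by
  have hn' : (0 : ℝ) < n := by exact_mod_cast hn
  have := iUnion_gridCell_Icc hn (i := ⟨0, hn⟩) (j := ⟨n - 1, by omega⟩)
  have e : Finset.Icc (⟨0, hn⟩ : Fin n) ⟨n - 1, by omega⟩ = Finset.univ := by
    ext s
    simp only [Finset.mem_Icc, Finset.mem_univ, iff_true, Fin.le_def]
    have := s.2
    omega
  rw [e] at this
  simp only [Finset.mem_univ, iUnion_true] at this
  rw [this]
  congr 1
  · simp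
  · rw [div_eq_one_iff_eq hn'.ne']
    have : ((n - 1 : ℕ) : ℝ) = n - 1 := by rw [Nat.cast_sub hn]; simp
    simp [this]

theorem gridCell_subset (hn : 0 < n) (s : Fin n) : gridCell n s ⊆ Ico 0 1 := by
  rw [← iUnion_gridCell hn]; exact subset_iUnion _ s

theorem volume_gridCell (s : Fin n) : (volume.restrict (gridCell n s)).real univ = 1 / n := by
  rw [measureReal_restrict_apply_univ, gridCell, Real.volume_real_Ico_of_le (by gcongr; linarith)]
  ring

theorem memLp_gridCell (hn : 0 < n) {f : ℝ → ℝ} (hf : MemLp f 2 (volume.restrict (Ioo 0 1)))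
    (s : Fin n) : MemLp f 2 (volume.restrict (gridCell n s)) := by
  rw [Measure.restrict_congr_set Ioo_ae_eq_Ico] at hf
  exact hf.mono_measure (Measure.restrict_mono (gridCell_subset hn s) le_rfl)

instance (s : Fin n) : IsFiniteMeasure (volume.restrict (gridCell n s)) := by
  unfold gridCell; infer_instance

theorem memLp_polynomial_unit (q : Polynomial ℝ) :
    MemLp (fun x => q.eval x) 2 (volume.restrict (Ioo 0 1)) := memLp_polynomial_Ioo q 0 1

theorem gridMean_sq_le (hn : 0 < n) {g : ℝ → ℝ} (s : Fin n)
    (hg : MemLp g 2 (volume.restrict (gridCell n s))) :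
    gridMean n g s ^ 2 ≤ n * ∫ x in gridCell n s, g x ^ 2 := by
  have hn' : (0 : ℝ) < n := by exact_mod_cast hn
  have := sq_integral_le hg
  rw [volume_gridCell] at this
  rw [gridMean, mul_pow]
  calc (n : ℝ) ^ 2 * (∫ x in gridCell n s, g x) ^ 2
      ≤ n ^ 2 * (1 / n * ∫ x in gridCell n s, g x ^ 2) := by gcongr
    _ = _ := by field_simp

theorem gridMean_sub_sq_le (hn : 0 < n) {f g : ℝ → ℝ} (s : Fin n)
    (hf : MemLp f 2 (volume.restrict (gridCell n s)))
    (hg : MemLp g 2 (volume.restrict (gridCell n s))) :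
    (gridMean n f s - gridMean n g s) ^ 2 ≤ n * ∫ x in gridCell n s, (f x - g x) ^ 2 := by
  have e : gridMean n f s - gridMean n g s = gridMean n (fun x => f x - g x) s := by
    rw [gridMean, gridMean, gridMean, integral_sub (hf.integrable (by norm_num))
      (hg.integrable (by norm_num)), mul_sub]
  rw [e]
  exact gridMean_sq_le hn s (hf.sub hg)

theorem gridMean_const (hn : 0 < n) (m : ℝ) (s : Fin n) : gridMean n (fun _ => m) s = m := by
  have hn' : (n : ℝ) ≠ 0 := by exact_mod_cast hn.ne'
  rw [gridMean, integral_const, volume_gridCell, smul_eq_mul]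
  field_simp

/-- The mean is the best constant approximation. -/
theorem integral_sub_gridMean_sq_le (hn : 0 < n) {f : ℝ → ℝ} (s : Fin n)
    (hf : MemLp f 2 (volume.restrict (gridCell n s))) (m : ℝ) :
    ∫ x in gridCell n s, (f x - gridMean n f s) ^ 2 ≤ ∫ x in gridCell n s, (f x - m) ^ 2 := by
  have hn' : (0 : ℝ) < n := by exact_mod_cast hn
  have key : ∀ m : ℝ, ∫ x in gridCell n s, (f x - m) ^ 2 =
      (∫ x in gridCell n s, f x ^ 2) - 2 * m * (∫ x in gridCell n s, f x) + m ^ 2 * (1 / n) := by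
    intro m
    have e : ∀ x, (f x - m) ^ 2 = f x ^ 2 - 2 * m * f x + m ^ 2 := fun x => by ring
    simp only [e]
    rw [integral_add (f := fun x => f x ^ 2 - 2 * m * f x)
        (hf.integrable_sq.sub ((hf.integrable (by norm_num)).const_mul _)) (integrable_const _),
      integral_sub hf.integrable_sq ((hf.integrable (by norm_num)).const_mul _),
      integral_const_mul, integral_const, volume_gridCell, smul_eq_mul]
    ring
  rw [key, key, gridMean]
  set I := ∫ x in gridCell n s, f x
  have : 0 ≤ (m - n * I) ^ 2 * (1 / n) := by positivity
  have e2 : (m - n * I) ^ 2 * (1 / n) =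
    m ^ 2 * (1 / n) - 2 * m * I + (2 * (n * I) * I - (n * I) ^ 2 * (1 / n)) := by
    field_simp; ring
  linarith

theorem gridEmbed_of_mem (hn : 0 < n) (z : Fin n → ℝ) {s : Fin n} {x : ℝ}
    (hx : x ∈ gridCell n s) : gridEmbed n z x = z s := by
  rw [gridEmbed, Finset.sum_eq_single s]
  · exact indicator_of_mem hx _
  · intro t _ hts
    exact indicator_of_notMem (fun h => hts (gridCell_eq_of_mem hn h hx)) _
  · simp

theorem sqError_eq_sum (hn : 0 < n) (z : Fin n → ℝ) {f : ℝ → ℝ}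
    (hf : MemLp f 2 (volume.restrict (Ioo 0 1))) :
    sqError n z f = ∑ s, ∫ x in gridCell n s, (z s - f x) ^ 2 := by
  have e : ∀ s, ∫ x in gridCell n s, (gridEmbed n z x - f x) ^ 2 =
      ∫ x in gridCell n s, (z s - f x) ^ 2 := fun s =>
    setIntegral_congr_fun (measurableSet_gridCell s) fun x hx => by
      simp only [gridEmbed_of_mem hn z hx]
  rw [sqError, ← iUnion_gridCell hn, integral_iUnion_fintype measurableSet_gridCell
    (disjoint_gridCell hn)]
  · exact Finset.sum_congr rfl fun s _ => e s
  · intro s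
    refine IntegrableOn.congr_fun (f := fun x => (z s - f x) ^ 2)
      ((memLp_const (z s)).sub (memLp_gridCell hn hf s)).integrable_sq (fun x hx => ?_)
      (measurableSet_gridCell s)
    simp only [gridEmbed_of_mem hn z hx]

/-- The step function of the cell means is inserted between the estimate and `f`, which separates
the estimation error on the grid from the discretization error. -/
theorem sqError_le (hn : 0 < n) (z : Fin n → ℝ) {f : ℝ → ℝ}
    (hf : MemLp f 2 (volume.restrict (Ioo 0 1))) :
    sqError n z f ≤ 2 * ((∑ s, (gridMean n f s - z s) ^ 2) / n) +
      2 * ∑ s, ∫ x in gridCell n s, (f x - gridMean n f s) ^ 2 := by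
  rw [sqError_eq_sum hn z hf, Finset.sum_div, Finset.mul_sum, Finset.mul_sum,
    ← Finset.sum_add_distrib]
  refine Finset.sum_le_sum fun s _ => ?_
  have hs := memLp_gridCell hn hf s
  have := integral_sq_le_two_mul (μ := volume.restrict (gridCell n s))
    (f := fun x => z s - f x) (g := fun x => gridMean n f s - f x)
    ((memLp_const _).sub hs) ((memLp_const _).sub hs)
  refine this.trans (le_of_eq ?_)
  have e1 : ∀ x, z s - f x - (gridMean n f s - f x) = z s - gridMean n f s := fun x => by ring
  have e2 : ∀ x, (gridMean n f s - f x) ^ 2 = (f x - gridMean n f s) ^ 2 := fun x => by ring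
  simp only [e1, e2]
  rw [integral_const, volume_gridCell, smul_eq_mul]
  ring

theorem sum_measureReal_gridCell_le (hn : 0 < n) (ν : Measure ℝ) [IsFiniteMeasure ν] :
    ∑ s, ν.real (gridCell n s) ≤ ν.real univ := by
  rw [← measureReal_biUnion_finset (fun s _ t _ hst => disjoint_gridCell hn hst)
    (fun s _ => measurableSet_gridCell s)]
  exact measureReal_mono (subset_univ _)

/-- The error of discretization. -/
theorem sum_integral_sub_gridMean_sq_le {α : ℝ} (hα : 0 < α) {f : ℝ → ℝ}
    (hf : MemLp f 2 (volume.restrict (Ioo 0 1))) {S : Finset ℝ} {ν : Measure ℝ} [IsFiniteMeasure ν]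
    (hν : ∀ c d, 0 ≤ c → c < d → d ≤ 1 → (∀ t ∈ S, t ∉ Ioo c d) → ∃ m : ℝ,
      ∫ x in Ioo c d, (f x - m) ^ 2 ≤ (d - c) ^ (2 * min α 1) * ν.real (Ioo c d))
    {C : ℝ} (hC0 : 0 ≤ C) (hC : ∀ c d, 0 ≤ c → c < d → d ≤ 1 →
      ∫ x in Ioo c d, f x ^ 2 ≤ C * (d - c) ^ (2 * α / (2 * α + 1))) (hn : 0 < n) :
    ∑ s, ∫ x in gridCell n s, (f x - gridMean n f s) ^ 2 ≤
      (ν.real univ + S.card * C) * (1 / n : ℝ) ^ (2 * α / (2 * α + 1)) := by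
  classical
  have hn' : (0 : ℝ) < n := by exact_mod_cast hn
  set r := 2 * α / (2 * α + 1) with hr
  have hx1 : (1 / n : ℝ) ≤ 1 := by
    rw [div_le_one hn']; exact_mod_cast hn
  -- Cells without breaks do better than needed, since `r` is at most both `2 α` and `1`.
  have hexp : (1 / n : ℝ) ^ (2 * min α 1) ≤ (1 / n : ℝ) ^ r := by
    apply Real.rpow_le_rpow_of_exponent_ge (by positivity) hx1
    rw [hr, div_le_iff₀ (by positivity)]
    rcases le_total α 1 with h | h
    · rw [min_eq_left h]; nlinarith
    · rw [min_eq_right h]; nlinarith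
  -- On a cell with a break inside, the mean is compared with the constant `0`, leaving the mass of
  -- `f ^ 2`. Cells being disjoint, there are at most `S.card` of these.
  set bad : Fin n → Prop := fun s => ∃ t ∈ S, t ∈ Ioo ((s : ℝ) / n) (((s : ℝ) + 1) / n) with hbad
  have hcell : ∀ s : Fin n, 0 ≤ (s : ℝ) / n ∧ (s : ℝ) / n < ((s : ℝ) + 1) / n ∧
      ((s : ℝ) + 1) / n ≤ 1 ∧ ((s : ℝ) + 1) / n - (s : ℝ) / n = 1 / n := by
    intro s
    refine ⟨by positivity, by gcongr; linarith, ?_, by ring⟩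
    rw [div_le_one hn']
    exact_mod_cast s.2
  have hpt : ∀ s, ∫ x in gridCell n s, (f x - gridMean n f s) ^ 2 ≤
      (ν.real (gridCell n s) + if bad s then C else 0) * (1 / n : ℝ) ^ r := by
    intro s
    obtain ⟨h1, h2, h3, h4⟩ := hcell s
    have hfs := memLp_gridCell hn hf s
    split_ifs with hb
    · have := integral_sub_gridMean_sq_le hn s hfs 0
      simp only [sub_zero] at this
      refine this.trans ?_
      rw [gridCell, integral_Ico_eq_integral_Ioo]
      refine (hC _ _ h1 h2 h3).trans ?_
      rw [h4]
      gcongr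
      have : 0 ≤ ν.real (Ico ((s : ℝ) / n) (((s : ℝ) + 1) / n)) := measureReal_nonneg
      linarith
    · have hb' : ∀ t ∈ S, t ∉ Ioo ((s : ℝ) / n) (((s : ℝ) + 1) / n) := fun t ht htt =>
        hb ⟨t, ht, htt⟩
      obtain ⟨m, hm⟩ := hν _ _ h1 h2 h3 hb'
      refine (integral_sub_gridMean_sq_le hn s hfs m).trans ?_
      rw [gridCell, integral_Ico_eq_integral_Ioo, add_zero, mul_comm]
      refine hm.trans ?_
      rw [h4]
      gcongr
      · finiteness
      · exact Ioo_subset_Ico_self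
  refine (Finset.sum_le_sum fun s _ => hpt s).trans ?_
  rw [← Finset.sum_mul, Finset.sum_add_distrib]
  have hcard : (Finset.univ.filter bad).card ≤ S.card := by
    choose! t ht ht' using (fun s (h : bad s) => h)
    refine Finset.card_le_card_of_injOn t (fun s hs => ht s (by simpa using hs)) ?_
    intro s hs s' hs' hss
    have a1 := ht' s (by simpa using hs)
    have a2 := ht' s' (by simpa using hs')
    rw [← hss] at a2
    exact gridCell_eq_of_mem hn (Ioo_subset_Ico_self a1) (Ioo_subset_Ico_self a2)
  gcongr
  · exact sum_measureReal_gridCell_le hn ν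
  · rw [← Finset.sum_filter, Finset.sum_const, nsmul_eq_mul]
    gcongr

end grid


/-! ### Segmentations adapted to the breaks -/

section segmentation

variable {n : ℕ}

theorem sum_gridMean_sub_sq_Icc_le (hn : 0 < n) {f g : ℝ → ℝ}
    (hf : MemLp f 2 (volume.restrict (Ioo 0 1))) (hg : MemLp g 2 (volume.restrict (Ioo 0 1)))
    (i j : Fin n) :
    ∑ s ∈ Finset.Icc i j, (gridMean n f s - gridMean n g s) ^ 2 ≤
      n * ∫ x in Ioo ((i : ℝ) / n) (((j : ℝ) + 1) / n), (f x - g x) ^ 2 := by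
  rw [← integral_Ico_eq_integral_Ioo, ← iUnion_gridCell_Icc hn,
    integral_biUnion_finset _ (fun s _ => measurableSet_gridCell s)
      (fun s _ t _ hst => disjoint_gridCell hn hst), Finset.mul_sum]
  · exact Finset.sum_le_sum fun s _ => gridMean_sub_sq_le hn s (memLp_gridCell hn hf s)
      (memLp_gridCell hn hg s)
  · exact fun s _ => ((memLp_gridCell hn hf s).sub (memLp_gridCell hn hg s)).integrable_sq

/-- Polynomial approximation of the discretized function on a discrete interval. -/
theorem exists_poly_approx_Icc {α : ℝ} (hα : 0 < α) {f : ℝ → ℝ} {p : ℕ}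
    (hf : MemLp f 2 (volume.restrict (Ioo 0 1))) {S : Finset ℝ} {ν : Measure ℝ} [IsFiniteMeasure ν]
    (hν : ∀ c d, 0 ≤ c → c < d → d ≤ 1 → (∀ t ∈ S, t ∉ Ioo c d) →
      ∃ q : Polynomial ℝ, q.natDegree ≤ p ∧
        ∫ x in Ioo c d, (f x - q.eval x) ^ 2 ≤ (d - c) ^ (2 * α) * ν.real (Ioo c d))
    (hn : 0 < n) {m : ℕ} {i j : Fin n} (hij : i ≤ j) (hm : (j : ℕ) + 1 ≤ i + m)
    (hgood : i < j → ∀ t ∈ S, t ∉ Ioo ((i : ℝ) / n) (((j : ℝ) + 1) / n)) :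
    ∃ q : Polynomial ℝ, q.natDegree ≤ p ∧
      ∑ s ∈ Finset.Icc i j, (gridMean n f s - gridMean n (fun x => q.eval x) s) ^ 2 ≤
        n * ((m / n : ℝ) ^ (2 * α) * ∑ s ∈ Finset.Icc i j, ν.real (gridCell n s)) := by
  have hn' : (0 : ℝ) < n := by exact_mod_cast hn
  rcases hij.eq_or_lt with rfl | hlt
  -- A single cell is fitted exactly by its own mean, so a break inside it does no harm.
  · refine ⟨Polynomial.C (gridMean n f i), by simp, ?_⟩
    simp only [Polynomial.eval_C, Finset.Icc_self, Finset.sum_singleton, gridMean_const hn,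
      sub_self]
    have : 0 ≤ ν.real (gridCell n i) := measureReal_nonneg
    simp only [ne_eq, OfNat.ofNat_ne_zero, not_false_eq_true, zero_pow]
    positivity
  · have h1 : (i : ℝ) + 1 ≤ j := by exact_mod_cast hlt
    have h2 : (j : ℝ) + 1 ≤ n := by exact_mod_cast j.2
    have h3 : (j : ℝ) + 1 ≤ i + m := by exact_mod_cast hm
    obtain ⟨q, hq, hq'⟩ := hν ((i : ℝ) / n) (((j : ℝ) + 1) / n) (by positivity)
      (by gcongr; linarith) (by rwa [div_le_one hn']) (hgood hlt)
    refine ⟨q, hq, (sum_gridMean_sub_sq_Icc_le hn hf (memLp_polynomial_unit q) i j).trans ?_⟩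
    refine mul_le_mul_of_nonneg_left (hq'.trans ?_) hn'.le
    rw [← measureReal_biUnion_finset (fun s _ t _ hst => disjoint_gridCell hn hst)
      (fun s _ => measurableSet_gridCell s), iUnion_gridCell_Icc hn, ← sub_div]
    have : (j : ℝ) + 1 - i ≤ m := by linarith
    have : 0 ≤ (j : ℝ) + 1 - i := by linarith
    gcongr
    · finiteness
    · exact Ioo_subset_Ico_self

/-- A monotone labelling of the grid: cells with equal labels are in the same block of `m` cells
and on the same side of each break, unless the cell is alone. -/
noncomputable def blockLabel (S : Finset ℝ) (n m : ℕ) (s : Fin n) : ℕ :=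
  (s : ℕ) / m + ∑ t ∈ S, ((if ⌊t * n⌋₊ ≤ (s : ℕ) then 1 else 0) +
    if ⌊t * n⌋₊ + 1 ≤ (s : ℕ) then 1 else 0)

theorem blockLabel_le (S : Finset ℝ) (m : ℕ) (s : Fin n) :
    blockLabel S n m s ≤ n / m + 2 * S.card := by
  refine add_le_add (Nat.div_le_div_right s.2.le) ?_
  rw [mul_comm, ← smul_eq_mul, ← Finset.sum_const]
  refine Finset.sum_le_sum fun t _ => ?_
  split_ifs <;> simp

theorem blockLabel_term_mono (t : ℝ) {s s' : Fin n} (h : s ≤ s') :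
    ((if ⌊t * n⌋₊ ≤ (s : ℕ) then 1 else 0) + if ⌊t * n⌋₊ + 1 ≤ (s : ℕ) then 1 else 0) ≤
    ((if ⌊t * n⌋₊ ≤ (s' : ℕ) then 1 else 0) + if ⌊t * n⌋₊ + 1 ≤ (s' : ℕ) then 1 else 0) := by
  have : (s : ℕ) ≤ s' := h
  split_ifs <;> omega

theorem blockLabel_mono (S : Finset ℝ) (m : ℕ) : Monotone (blockLabel S n m) := fun _ _ h =>
  add_le_add (Nat.div_le_div_right h) (Finset.sum_le_sum fun t _ => blockLabel_term_mono t h)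

/-- All summands of the label are monotone, so equal labels force every summand to be equal. A break
`t` inside the interval has `i ≤ ⌊t * n⌋₊ ≤ j`; the first indicator then forces `i = ⌊t * n⌋₊`, and
the second separates this cell from all later ones. -/
theorem blockLabel_eq {S : Finset ℝ} (hS : ∀ t ∈ S, 0 ≤ t) (hn : 0 < n) {m : ℕ} (hm : 0 < m)
    {i j : Fin n} (hij : i ≤ j) (h : blockLabel S n m i = blockLabel S n m j) :
    (j : ℕ) + 1 ≤ i + m ∧ (i < j → ∀ t ∈ S, t ∉ Ioo ((i : ℝ) / n) (((j : ℝ) + 1) / n)) := by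
  have hn' : (0 : ℝ) < n := by exact_mod_cast hn
  have a1 : (i : ℕ) / m ≤ (j : ℕ) / m := Nat.div_le_div_right hij
  have a2 := Finset.sum_le_sum fun t (_ : t ∈ S) => blockLabel_term_mono t hij
  have h1 : (i : ℕ) / m = (j : ℕ) / m := by unfold blockLabel at h; omega
  have h2 := (Finset.sum_eq_sum_iff_of_le fun t (_ : t ∈ S) => blockLabel_term_mono t hij).1
    (by unfold blockLabel at h; omega)
  constructor
  · have e1 := Nat.div_add_mod (i : ℕ) m
    have e2 := Nat.div_add_mod (j : ℕ) m
    have e3 := Nat.mod_lt (j : ℕ) hm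
    rw [h1] at e1
    omega
  · intro hlt t ht htt
    have hlt' : (i : ℕ) < j := hlt
    have b1 := htt.1
    have b2 := htt.2
    rw [div_lt_iff₀ hn'] at b1
    rw [lt_div_iff₀ hn'] at b2
    have c1 : (i : ℕ) ≤ ⌊t * n⌋₊ := Nat.le_floor b1.le
    have c2 : ⌊t * n⌋₊ < (j : ℕ) + 1 := by
      rw [Nat.floor_lt (mul_nonneg (hS t ht) hn'.le)]; exact_mod_cast b2
    have := h2 t ht
    split_ifs at this <;> omega

/-- Level sets of a monotone labelling are intervals. -/
theorem filter_blockLabel_eq_Icc (S : Finset ℝ) (m : ℕ) (a : Fin n) :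
    ∃ i j : Fin n, i ≤ j ∧ blockLabel S n m i = blockLabel S n m a ∧
      blockLabel S n m j = blockLabel S n m a ∧
      (Finset.univ.filter fun b => blockLabel S n m b = blockLabel S n m a) = Finset.Icc i j := by
  set F := Finset.univ.filter fun b => blockLabel S n m b = blockLabel S n m a with hF
  have hne : F.Nonempty := ⟨a, by simp [hF]⟩
  have h1 : blockLabel S n m (F.min' hne) = blockLabel S n m a := by
    have := F.min'_mem hne
    simpa [hF] using this
  have h2 : blockLabel S n m (F.max' hne) = blockLabel S n m a := by
    have := F.max'_mem hne
    simpa [hF] using this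
  refine ⟨F.min' hne, F.max' hne, F.min'_le_max' hne, h1, h2, ?_⟩
  ext b
  rw [Finset.mem_Icc]
  refine ⟨fun hb => ⟨F.min'_le b hb, F.le_max' b hb⟩, fun ⟨hb1, hb2⟩ => ?_⟩
  have m1 := blockLabel_mono S m hb1
  have m2 := blockLabel_mono S m hb2
  simp only [hF, Finset.mem_filter, Finset.mem_univ, true_and]
  omega

/-- The parts are the level sets of `blockLabel`: at most `n / m + 1` blocks, plus two further cuts
per break. The local errors add up to the total mass of `ν`. -/
theorem exists_segmentation {α : ℝ} (hα : 0 < α) {f : ℝ → ℝ} {p : ℕ}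
    (hf : MemLp f 2 (volume.restrict (Ioo 0 1))) {S : Finset ℝ} (hS : ∀ t ∈ S, 0 ≤ t)
    {ν : Measure ℝ} [IsFiniteMeasure ν]
    (hν : ∀ c d, 0 ≤ c → c < d → d ≤ 1 → (∀ t ∈ S, t ∉ Ioo c d) →
      ∃ q : Polynomial ℝ, q.natDegree ≤ p ∧
        ∫ x in Ioo c d, (f x - q.eval x) ^ 2 ≤ (d - c) ^ (2 * α) * ν.real (Ioo c d))
    (hn : 0 < n) {m : ℕ} (hm : 0 < m) :
    ∃ (Q : Finpartition (Finset.univ : Finset (Fin n))) (h : Fin n → ℝ), IsSegmentation p Q h ∧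
      Q.parts.card ≤ n / m + 2 * S.card + 1 ∧
      (∑ s, (gridMean n f s - h s) ^ 2) / n ≤ (m / n : ℝ) ^ (2 * α) * ν.real univ := by
  classical
  have hn' : (0 : ℝ) < n := by exact_mod_cast hn
  set κ := blockLabel S n m with hκ
  have hq : ∀ v ∈ Finset.univ.image κ, ∃ q : Polynomial ℝ, q.natDegree ≤ p ∧
      ∑ s ∈ Finset.univ.filter (fun b => κ b = v),
        (gridMean n f s - gridMean n (fun x => q.eval x) s) ^ 2 ≤
        n * ((m / n : ℝ) ^ (2 * α) *
          ∑ s ∈ Finset.univ.filter (fun b => κ b = v), ν.real (gridCell n s)) := by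
    intro v hv
    obtain ⟨a, -, rfl⟩ := Finset.mem_image.1 hv
    obtain ⟨i, j, hij, hi, hj, hF⟩ := filter_blockLabel_eq_Icc S m a
    rw [← hκ] at hF
    rw [hF]
    obtain ⟨h1, h2⟩ := blockLabel_eq hS hn hm hij (hi.trans hj.symm)
    exact exists_poly_approx_Icc hα hf hν hn hij h1 h2
  choose! q hqd hqe using hq
  have hparts : (Finpartition.ofSetoid (Setoid.ker κ)).parts =
      (Finset.univ.image κ).image fun v => Finset.univ.filter fun b => κ b = v := by
    rw [Finpartition.ofSetoid, Finpartition.ofSetSetoid_parts, Finset.image_image]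
    refine Finset.image_congr fun a _ => ?_
    ext b
    simp [Setoid.ker_def, eq_comm]
  refine ⟨Finpartition.ofSetoid (Setoid.ker κ),
    fun s => gridMean n (fun x => (q (κ s)).eval x) s, ⟨?_, ?_⟩, ?_, ?_⟩
  · intro R hR
    rw [hparts, Finset.image_image] at hR
    obtain ⟨a, -, rfl⟩ := Finset.mem_image.1 hR
    obtain ⟨i, j, hij, hi, hj, hF⟩ := filter_blockLabel_eq_Icc S m a
    exact Finset.mem_image.2 ⟨(i, j), by simpa using hij, hF.symm⟩
  · have e : (fun s => gridMean n (fun x => (q (κ s)).eval x) s) =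
        ∑ v ∈ Finset.univ.image κ, (((Finset.univ.filter fun b => κ b = v : Finset (Fin n)) :
          Set (Fin n)).indicator (gridMean n fun x => (q v).eval x)) := by
      ext s
      rw [Finset.sum_apply, Finset.sum_eq_single (κ s)]
      · rw [indicator_of_mem]; simp
      · intro v _ hv
        rw [indicator_of_notMem]
        simpa using hv.symm
      · simp
    rw [e]
    refine Submodule.sum_mem _ fun v hv => ?_
    have hle : fragmentSpace p n (Finset.univ.filter fun b => κ b = v) ≤
        partitionSpace p (Finpartition.ofSetoid (Setoid.ker κ)) := by
      unfold partitionSpace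
      refine le_iSup₂_of_le (Finset.univ.filter fun b => κ b = v) ?_ le_rfl
      rw [hparts]
      exact Finset.mem_image_of_mem _ hv
    exact hle (Submodule.subset_span ⟨q v, hqd v hv, rfl⟩)
  · rw [hparts]
    refine Finset.card_image_le.trans ?_
    have : Finset.univ.image κ ⊆ Finset.range (n / m + 2 * S.card + 1) := by
      intro v hv
      obtain ⟨a, -, rfl⟩ := Finset.mem_image.1 hv
      exact Finset.mem_range.2 (Nat.lt_succ_of_le (blockLabel_le S m a))
    simpa using Finset.card_le_card this
  · rw [div_le_iff₀ hn']
    have hfib : ∀ g : Fin n → ℝ, ∑ s, g s =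
        ∑ v ∈ Finset.univ.image κ, ∑ s ∈ Finset.univ.filter (fun b => κ b = v), g s :=
      fun g => (Finset.sum_fiberwise_of_maps_to
        (fun s _ => Finset.mem_image_of_mem κ (Finset.mem_univ s)) g).symm
    calc _ = ∑ v ∈ Finset.univ.image κ, ∑ s ∈ Finset.univ.filter (fun b => κ b = v),
          (gridMean n f s - gridMean n (fun x => (q v).eval x) s) ^ 2 := by
          rw [hfib]
          refine Finset.sum_congr rfl fun v _ => Finset.sum_congr rfl fun s hs => ?_
          simp only [(Finset.mem_filter.1 hs).2]
      _ ≤ ∑ v ∈ Finset.univ.image κ, n * ((m / n : ℝ) ^ (2 * α) *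
          ∑ s ∈ Finset.univ.filter (fun b => κ b = v), ν.real (gridCell n s)) :=
          Finset.sum_le_sum hqe
      _ = n * ((m / n : ℝ) ^ (2 * α) * ∑ s, ν.real (gridCell n s)) := by
          rw [hfib (fun s => ν.real (gridCell n s)), Finset.mul_sum, Finset.mul_sum]
      _ ≤ n * ((m / n : ℝ) ^ (2 * α) * ν.real univ) := by
          gcongr
          exact sum_measureReal_gridCell_le hn ν
      _ = _ := by ring

end segmentation


/-! ### The oracle inequality -/

section oracle

variable {n : ℕ}

theorem mem_intervalFragments {R : Finset (Fin n)} :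
    R ∈ intervalFragments n ↔ ∃ i j, i ≤ j ∧ Finset.Icc i j = R := by
  simp [intervalFragments]

/-- Restriction to a set of grid points. -/
noncomputable def restrictGrid (R : Finset (Fin n)) : (Fin n → ℝ) →ₗ[ℝ] (Fin n → ℝ) where
  toFun := (R : Set (Fin n)).indicator
  map_add' v w := indicator_add _ v w
  map_smul' c v := indicator_const_smul _ c v

theorem restrictGrid_mem {p : ℕ} {Q : Finpartition (Finset.univ : Finset (Fin n))}
    {R R' : Finset (Fin n)} (hR' : R' ∈ Q.parts) (hRR' : R ⊆ R') {h : Fin n → ℝ}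
    (hh : h ∈ partitionSpace p Q) : restrictGrid R h ∈ fragmentSpace p n R := by
  suffices H : partitionSpace p Q ≤ (fragmentSpace p n R).comap (restrictGrid R) from H hh
  refine iSup₂_le fun R₂ hR₂ => Submodule.span_le.2 ?_
  rintro _ ⟨q, hq, rfl⟩
  change (R : Set (Fin n)).indicator ((R₂ : Set (Fin n)).indicator _) ∈ fragmentSpace p n R
  rw [indicator_indicator]
  by_cases he : R₂ = R'
  · subst he
    rw [inter_eq_self_of_subset_left (by exact_mod_cast hRR')]
    exact Submodule.subset_span ⟨q, hq, rfl⟩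
  · have hd : Disjoint R₂ R' := Q.disjoint hR₂ hR' he
    have : (R : Set (Fin n)) ∩ R₂ = ∅ := by
      rw [← Set.disjoint_iff_inter_eq_empty]
      exact_mod_cast (hd.mono_right hRR').symm
    rw [this, indicator_empty]
    exact Submodule.zero_mem _

theorem exists_of_mem_inf_parts {Q Q' : Finpartition (Finset.univ : Finset (Fin n))}
    {R : Finset (Fin n)} (hR : R ∈ (Q ⊓ Q').parts) :
    ∃ A ∈ Q.parts, ∃ B ∈ Q'.parts, R = A ∩ B ∧ R.Nonempty := by
  have hne := (Q ⊓ Q').nonempty_of_mem_parts hR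
  rw [Finpartition.parts_inf, Finset.mem_erase, Finset.mem_image] at hR
  obtain ⟨-, ⟨A, B⟩, hAB, rfl⟩ := hR
  rw [Finset.mem_product] at hAB
  exact ⟨A, hAB.1, B, hAB.2, rfl, hne⟩

theorem min_Icc_fin {i j : Fin n} (hij : i ≤ j) : (Finset.Icc i j).min = i := by
  apply le_antisymm
  · exact Finset.min_le (Finset.left_mem_Icc.2 hij)
  · exact Finset.le_min fun b hb => by exact_mod_cast (Finset.mem_Icc.1 hb).1

theorem inf_part_of_intervals {Q Q' : Finpartition (Finset.univ : Finset (Fin n))}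
    (hQ : IsIntervalPartition Q) (hQ' : IsIntervalPartition Q') {R : Finset (Fin n)}
    (hR : R ∈ (Q ⊓ Q').parts) : R ∈ intervalFragments n ∧
      R.min ∈ Q.parts.image Finset.min ∪ Q'.parts.image Finset.min := by
  obtain ⟨A, hA, B, hB, rfl, hne⟩ := exists_of_mem_inf_parts hR
  obtain ⟨a, b, hab, rfl⟩ := mem_intervalFragments.1 (hQ hA)
  obtain ⟨c, d, hcd, rfl⟩ := mem_intervalFragments.1 (hQ' hB)
  have e : Finset.Icc a b ∩ Finset.Icc c d = Finset.Icc (max a c) (min b d) := by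
    ext s; simp only [Finset.mem_inter, Finset.mem_Icc, max_le_iff, le_min_iff]; tauto
  rw [e] at hne ⊢
  have hle := Finset.nonempty_Icc.1 hne
  refine ⟨mem_intervalFragments.2 ⟨_, _, hle, rfl⟩, ?_⟩
  rw [min_Icc_fin hle, Finset.mem_union]
  rcases le_total a c with h | h
  · right; rw [max_eq_right h]
    exact Finset.mem_image.2 ⟨_, hB, min_Icc_fin hcd⟩
  · left; rw [max_eq_left h]
    exact Finset.mem_image.2 ⟨_, hA, min_Icc_fin hab⟩

/-- Every interval of the common refinement starts where one of `Q` or `Q'` starts, and a part is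
determined by its least element. -/
theorem card_inf_parts_le {Q Q' : Finpartition (Finset.univ : Finset (Fin n))}
    (hQ : IsIntervalPartition Q) (hQ' : IsIntervalPartition Q') :
    (Q ⊓ Q').parts.card ≤ Q.parts.card + Q'.parts.card := by
  calc (Q ⊓ Q').parts.card
      ≤ (Q.parts.image Finset.min ∪ Q'.parts.image Finset.min).card := by
        refine Finset.card_le_card_of_injOn Finset.min
          (fun R hR => (inf_part_of_intervals hQ hQ' hR).2) fun R hR R' hR' he => ?_
        obtain ⟨a, ha⟩ := Finset.min_of_nonempty ((Q ⊓ Q').nonempty_of_mem_parts hR)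
        exact (Q ⊓ Q').eq_of_mem_parts hR hR' (Finset.mem_of_min ha)
          (Finset.mem_of_min (he ▸ ha))
    _ ≤ _ := (Finset.card_union_le _ _).trans
        (add_le_add Finset.card_image_le Finset.card_image_le)

theorem sum_eq_sum_parts (Q : Finpartition (Finset.univ : Finset (Fin n))) (g : Fin n → ℝ) :
    ∑ s, g s = ∑ R ∈ Q.parts, ∑ s ∈ R, g s := by
  have := Finset.sum_biUnion (f := g) Q.disjoint
  rwa [Q.biUnion_parts] at this

/-- On every part of the common refinement `h - h'` restricts to an element of a fragment space.
Cauchy–Schwarz over the parts turns the local bounds into a global one, with the number of parts as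
a factor. -/
theorem sq_sum_mul_le_of_fragments {p : ℕ} {ξ : Fin n → ℝ} {T : ℝ} (hT0 : 0 ≤ T)
    (hT : ∀ R ∈ intervalFragments n, ∀ v ∈ fragmentSpace p n R,
      (∑ s, v s * ξ s) ^ 2 ≤ T * ∑ s, v s ^ 2)
    {Q Q' : Finpartition (Finset.univ : Finset (Fin n))} {h h' : Fin n → ℝ}
    (hh : IsSegmentation p Q h) (hh' : IsSegmentation p Q' h') :
    (∑ s, (h s - h' s) * ξ s) ^ 2 ≤
      T * (Q.parts.card + Q'.parts.card) * ∑ s, (h s - h' s) ^ 2 := by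
  have hR : ∀ R ∈ (Q ⊓ Q').parts, (∑ s ∈ R, (h s - h' s) * ξ s) ^ 2 ≤
      T * ∑ s ∈ R, (h s - h' s) ^ 2 := by
    intro R hR
    obtain ⟨A, hA, B, hB, rfl, -⟩ := exists_of_mem_inf_parts hR
    have hmem : restrictGrid (A ∩ B) (h - h') ∈ fragmentSpace p n (A ∩ B) := by
      rw [map_sub]
      exact Submodule.sub_mem _ (restrictGrid_mem hA Finset.inter_subset_left hh.2)
        (restrictGrid_mem hB Finset.inter_subset_right hh'.2)
    have := hT _ (inf_part_of_intervals hh.1 hh'.1 hR).1 _ hmem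
    have e : ∀ s, restrictGrid (A ∩ B) (h - h') s =
        if s ∈ A ∩ B then h s - h' s else 0 := by
      intro s
      change ((A ∩ B : Finset (Fin n)) : Set (Fin n)).indicator (h - h') s = _
      rw [indicator_apply]
      rfl
    simp only [e, ite_mul, zero_mul, ite_pow, ne_eq, OfNat.ofNat_ne_zero, not_false_eq_true,
      zero_pow, Finset.sum_ite_mem, Finset.univ_inter] at this
    exact this
  rw [sum_eq_sum_parts (Q ⊓ Q'), sum_eq_sum_parts (Q ⊓ Q') (fun s => (h s - h' s) ^ 2)]
  refine sq_sum_le_card_mul_sum_sq.trans ?_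
  have hc : ((Q ⊓ Q').parts.card : ℝ) ≤ Q.parts.card + Q'.parts.card := by
    exact_mod_cast card_inf_parts_le hh.1 hh'.1
  have h0 : 0 ≤ ∑ R ∈ (Q ⊓ Q').parts, ∑ s ∈ R, (h s - h' s) ^ 2 :=
    Finset.sum_nonneg fun R _ => Finset.sum_nonneg fun s _ => sq_nonneg _
  calc _ ≤ ((Q ⊓ Q').parts.card : ℝ) *
        ∑ R ∈ (Q ⊓ Q').parts, T * ∑ s ∈ R, (h s - h' s) ^ 2 := by
        gcongr with R hR'
        exact hR R hR'
    _ = T * (Q ⊓ Q').parts.card * ∑ R ∈ (Q ⊓ Q').parts, ∑ s ∈ R, (h s - h' s) ^ 2 := by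
        rw [← Finset.mul_sum]; ring
    _ ≤ _ := by gcongr

theorem oracle_inequality {p : ℕ} (hn : 0 < n) {f ξ : Fin n → ℝ} {γ θ : ℝ} (hγ : 0 < γ)
    (hθ : 0 < θ) (hθ1 : θ < 1)
    (hT : ∀ R ∈ intervalFragments n, ∀ v ∈ fragmentSpace p n R,
      (∑ s, v s * ξ s) ^ 2 ≤ θ * (n * γ) * ∑ s, v s ^ 2)
    {Q Q' : Finpartition (Finset.univ : Finset (Fin n))} {h h' : Fin n → ℝ}
    (hest : IsEstimate p γ (fun s => f s + ξ s) Q' h') (hh : IsSegmentation p Q h) :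
    (∑ s, (f s - h' s) ^ 2) / n ≤ 2 / (1 - θ) * (4 + 2 / (1 - θ)) *
      (γ * Q.parts.card + (∑ s, (f s - h s) ^ 2) / n) := by
  have hn' : (0 : ℝ) < n := by exact_mod_cast hn
  obtain ⟨hseg, hmin⟩ := hest
  have hcmp := hmin Q h hh
  unfold penalizedLS at hcmp
  set E := ∑ s, (f s - h' s) ^ 2 with hE
  set A := ∑ s, (f s - h s) ^ 2 with hA
  set X := ∑ s, (h' s - h s) * ξ s with hX
  set V := ∑ s, (h' s - h s) ^ 2 with hV
  have hA0 : 0 ≤ A := Finset.sum_nonneg fun s _ => sq_nonneg _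
  have hV0 : 0 ≤ V := Finset.sum_nonneg fun s _ => sq_nonneg _
  have key : E ≤ n * γ * (Q.parts.card - Q'.parts.card) + A + 2 * X := by
    have e : ∑ s, (f s + ξ s - h' s) ^ 2 = ∑ s, (f s + ξ s - h s) ^ 2 + E - A - 2 * X := by
      rw [hE, hA, hX, Finset.mul_sum, ← Finset.sum_add_distrib, ← Finset.sum_sub_distrib,
        ← Finset.sum_sub_distrib]
      exact Finset.sum_congr rfl fun s _ => by ring
    rw [e] at hcmp
    have := mul_le_mul_of_nonneg_left hcmp hn'.le
    rw [mul_add, mul_add, mul_div_cancel₀ _ hn'.ne', mul_div_cancel₀ _ hn'.ne'] at this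
    linarith
  set U := n * γ * (Q.parts.card + Q'.parts.card : ℝ) with hU
  have hU0 : 0 ≤ U := by positivity
  have hXsq : X ^ 2 ≤ θ * U * V := by
    have := sq_sum_mul_le_of_fragments (by positivity) hT hseg hh
    refine this.trans (le_of_eq ?_)
    rw [hU]; ring
  have h2X : 2 * X ≤ U + θ * V := by
    apply le_of_sq_le_sq _ (by positivity)
    nlinarith [sq_nonneg (U - θ * V)]
  -- Chosen such that `θ * (1 + η) = (1 + θ) / 2 < 1`, so that the share of `E` in `θ * V` can be
  -- absorbed.
  set η := (1 - θ) / (2 * θ) with hη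
  have hη0 : 0 < η := by rw [hη]; apply div_pos <;> linarith
  have hVle : V ≤ (1 + η) * E + (1 + 1 / η) * A := by
    rw [hV, hE, hA, Finset.mul_sum, Finset.mul_sum, ← Finset.sum_add_distrib]
    refine Finset.sum_le_sum fun s _ => ?_
    set x := f s - h s
    set y := f s - h' s
    have e1 : h' s - h s = x - y := by simp only [x, y]; ring
    rw [e1]
    have : 0 ≤ (η * y + x) ^ 2 / η := by positivity
    have e2 : (η * y + x) ^ 2 / η = η * y ^ 2 + 2 * x * y + 1 / η * x ^ 2 := by
      field_simp; ring
    nlinarith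
  have e1 : θ * (1 + η) = (1 + θ) / 2 := by rw [hη]; field_simp; ring
  have h1θ : 0 < 1 - θ := by linarith
  have e2 : θ * (1 + 1 / η) ≤ 1 + 2 / (1 - θ) := by
    have : θ * (1 + 1 / η) = θ + 2 * θ ^ 2 / (1 - θ) := by rw [hη]; field_simp
    rw [this]
    have : 2 * θ ^ 2 / (1 - θ) ≤ 2 / (1 - θ) := by
      gcongr; nlinarith
    linarith
  have hθV : θ * V ≤ (1 + θ) / 2 * E + (1 + 2 / (1 - θ)) * A := by
    calc θ * V ≤ θ * ((1 + η) * E + (1 + 1 / η) * A) := by gcongr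
      _ = θ * (1 + η) * E + θ * (1 + 1 / η) * A := by ring
      _ ≤ _ := by rw [e1]; gcongr
  have hfin : (1 - θ) / 2 * E ≤ (4 + 2 / (1 - θ)) * (n * γ * Q.parts.card + A) := by
    have a1 : 0 ≤ n * γ * (Q.parts.card : ℝ) := by positivity
    have a2 : 0 ≤ 2 / (1 - θ) := by positivity
    -- The terms `± n γ |Q'|` from `key` and `U` cancel: the penalty pays for the unknown complexity
    -- of the estimate.
    have : (1 - θ) / 2 * E ≤ 2 * (n * γ * Q.parts.card) + (2 + 2 / (1 - θ)) * A := by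
      rw [hU] at h2X
      linarith
    nlinarith [mul_nonneg a2 a1]
  rw [div_le_iff₀ hn']
  calc E = 2 / (1 - θ) * ((1 - θ) / 2 * E) := by field_simp
    _ ≤ 2 / (1 - θ) * ((4 + 2 / (1 - θ)) * (n * γ * Q.parts.card + A)) := by gcongr
    _ = _ := by field_simp

end oracle


/-! ### Bounds for the noise -/

theorem eventually_along {M : Set ℕ} {q : ℕ → Prop} :
    (∀ᶠ n in along M, q n) ↔ ∀ᶠ n in atTop, n ∈ M → q n := eventually_inf_principal

section noise

variable {Ω : Type*} [MeasurableSpace Ω] {P : Measure Ω} {M : Set ℕ} {β : ℝ}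
  {ξ : (n : ℕ) → Fin n → Ω → ℝ}

theorem TailCondition.measureReal_lt_sq [IsProbabilityMeasure P] (hβ : 0 < β)
    (hξ : TailCondition P M β ξ) {n : ℕ} (hn : n ∈ M) (hn0 : 0 < n) {x : ℝ} (hx : 0 < x)
    (v : Fin n → ℝ) :
    P.real {ω | x * β * Real.log n * ∑ s, v s ^ 2 < (∑ s, v s * ξ n s ω) ^ 2} ≤
      2 * (n : ℝ) ^ (-x) := by
  have hn' : (0 : ℝ) < n := by exact_mod_cast hn0
  have hL : 0 ≤ Real.log n := Real.log_natCast_nonneg n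
  set V := ∑ s, v s ^ 2 with hV
  have hV0 : 0 ≤ V := Finset.sum_nonneg fun s _ => sq_nonneg _
  -- For `v = 0` the quotient in the tail bound is `0` by convention and the bound says nothing; the
  -- strict inequality makes the event empty instead.
  rcases hV0.eq_or_lt with h0 | hpos
  · have hv : ∀ s, v s = 0 := by
      intro s
      have := (Finset.sum_eq_zero_iff_of_nonneg fun s _ => sq_nonneg (v s)).1 h0.symm s
        (Finset.mem_univ s)
      exact pow_eq_zero_iff (two_ne_zero) |>.1 this
    have : {ω | x * β * Real.log n * V < (∑ s, v s * ξ n s ω) ^ 2} = ∅ := by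
      ext ω
      simp [← h0, hv]
    rw [this]
    simp only [measureReal_empty]
    positivity
  · have h1 := hξ n hn v (√(x * β * Real.log n * V)) (Real.sqrt_nonneg _)
    refine (measureReal_mono ?_).trans (h1.trans (le_of_eq ?_))
    · intro ω hω
      exact Real.sqrt_le_iff.2 ⟨abs_nonneg _, (sq_abs (∑ s, v s * ξ n s ω)).symm ▸ le_of_lt hω⟩
    · rw [Real.sq_sqrt (by positivity), ← hV, Real.rpow_def_of_pos hn']
      congr 2
      field_simp

/-- The Borel–Cantelli argument for finite families of test vectors. -/
theorem TailCondition.ae_eventually_le [IsProbabilityMeasure P] (hβ : 0 < β)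
    (hξ : TailCondition P M β ξ) (F : (n : ℕ) → Finset (Fin n → ℝ)) {K x y : ℝ} (hx : 0 < x)
    (hxy : y + 1 < x) (hF : ∀ n, 0 < n → ((F n).card : ℝ) ≤ K * (n : ℝ) ^ y) :
    ∀ᵐ ω ∂P, ∀ᶠ n in along M, ∀ v ∈ F n,
      (∑ s, v s * ξ n s ω) ^ 2 ≤ x * β * Real.log n * ∑ s, v s ^ 2 := by
  classical
  -- Stages outside `M` contribute the empty set, so Borel–Cantelli applies along all of `ℕ`; the
  -- series converges because `y - x < -1`.
  set B : ℕ → Set Ω := fun n => if n ∈ M ∧ 0 < n then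
    ⋃ v ∈ F n, {ω | x * β * Real.log n * ∑ s, v s ^ 2 < (∑ s, v s * ξ n s ω) ^ 2} else ∅ with hB
  have hK : 0 ≤ K := by
    have := (Nat.cast_nonneg (F 1).card).trans (hF 1 one_pos)
    simpa using this
  have hBle : ∀ n, P (B n) ≤ ENNReal.ofReal (2 * K * (n : ℝ) ^ (y - x)) := by
    intro n
    by_cases hn : n ∈ M ∧ 0 < n
    · have hn' : (0 : ℝ) < n := by exact_mod_cast hn.2
      rw [← ofReal_measureReal]
      apply ENNReal.ofReal_le_ofReal
      simp only [hB, hn, and_self, if_true]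
      refine (measureReal_biUnion_finset_le _ _).trans ?_
      refine (Finset.sum_le_sum fun v _ => hξ.measureReal_lt_sq hβ hn.1 hn.2 hx v).trans ?_
      rw [Finset.sum_const, nsmul_eq_mul, sub_eq_add_neg y, Real.rpow_add hn']
      calc ((F n).card : ℝ) * (2 * (n : ℝ) ^ (-x))
          ≤ (K * (n : ℝ) ^ y) * (2 * (n : ℝ) ^ (-x)) := by gcongr; exact hF n hn.2
        _ = _ := by ring
    · simp only [hB, hn, if_false, measure_empty]
      exact zero_le
  have hsum : ∑' n, P (B n) ≠ ⊤ := by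
    have hs : Summable fun n : ℕ => 2 * K * (n : ℝ) ^ (y - x) :=
      (Real.summable_nat_rpow.2 (by linarith)).mul_left _
    exact ne_top_of_le_ne_top hs.tsum_ofReal_ne_top (ENNReal.tsum_le_tsum hBle)
  filter_upwards [ae_eventually_notMem hsum] with ω hω
  rw [eventually_along]
  filter_upwards [hω, eventually_gt_atTop 0] with n hn hn0 hnM v hv
  by_contra! hlt
  apply hn
  simp only [hB, hnM, hn0, and_self, if_true]
  exact mem_biUnion (x := v) hv hlt

end noise

/-! ### Test vectors for spaces of bounded dimension -/

section orthonormal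

variable {n : ℕ}

/-- `Fin n → ℝ` carries the sup norm, so the basis is constructed in `EuclideanSpace` and read off
in coordinates. -/
theorem exists_orthonormal_system (W : Submodule ℝ (Fin n → ℝ)) {d : ℕ}
    (hW : Module.finrank ℝ W = d) : ∃ e : Fin d → Fin n → ℝ,
      (∀ i j, ∑ s, e i s * e j s = if i = j then 1 else 0) ∧
      ∀ v ∈ W, ∃ c : Fin d → ℝ, ∀ s, v s = ∑ i, c i * e i s := by
  let T := (WithLp.linearEquiv 2 ℝ (Fin n → ℝ)).symm
  let W' : Submodule ℝ (EuclideanSpace ℝ (Fin n)) := W.map T.toLinearMap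
  have hd : Module.finrank ℝ W' = d := (LinearEquiv.finrank_map_eq T W).trans hW
  let b := (stdOrthonormalBasis ℝ W').reindex (finCongr hd)
  refine ⟨fun i s => (b i : EuclideanSpace ℝ (Fin n)) s, fun i j => ?_, fun v hv => ?_⟩
  · have h1 := orthonormal_iff_ite.1 b.orthonormal i j
    rw [Submodule.coe_inner, PiLp.inner_apply] at h1
    rw [← h1]
    exact Finset.sum_congr rfl fun s _ => by simp [mul_comm]
  · have hv' : T v ∈ W' := Submodule.mem_map_of_mem hv
    refine ⟨fun i => b.repr ⟨T v, hv'⟩ i, fun s => ?_⟩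
    have h2 := congrArg (fun w : W' => (w : EuclideanSpace ℝ (Fin n)) s)
      (b.sum_repr ⟨T v, hv'⟩)
    simp only [Submodule.coe_sum, Submodule.coe_smul] at h2
    have h3 : (T v : EuclideanSpace ℝ (Fin n)) s = v s := rfl
    rw [h3] at h2
    rw [← h2]
    simp

/-- Finitely many test vectors control a space of dimension at most `D` up to a factor `√D`. -/
theorem exists_test_vectors (W : Submodule ℝ (Fin n → ℝ)) {D : ℕ}
    (hD : Module.finrank ℝ W ≤ D) :
    ∃ F : Finset (Fin n → ℝ), F.card ≤ D + 2 ^ D ∧ ∀ (ξ : Fin n → ℝ) (t : ℝ), 0 ≤ t →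
      (∀ v ∈ F, (∑ s, v s * ξ s) ^ 2 ≤ t * ∑ s, v s ^ 2) →
      ∀ v ∈ W, (∑ s, v s * ξ s) ^ 2 ≤ √D * t * ∑ s, v s ^ 2 := by
  classical
  obtain ⟨d, hd⟩ : ∃ d, Module.finrank ℝ W = d := ⟨_, rfl⟩
  rw [hd] at hD
  obtain ⟨e, he, hW⟩ := exists_orthonormal_system W hd
  let sg : Bool → ℝ := fun b => if b then 1 else -1
  have hsg : ∀ b, sg b ^ 2 = 1 := fun b => by cases b <;> simp [sg]
  -- Each sign combination has squared norm `d`, and the one with the signs of `z` pairs with `ξ` to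
  -- `∑ |z i|`. Hence `∑ |z i| ≤ √(t D)`, and with `|z i| ≤ √t` also `∑ z i ^ 2 ≤ √D t`; the basis
  -- alone would only give `D t`.
  let u : (Fin d → Bool) → Fin n → ℝ := fun σ s => ∑ i, sg (σ i) * e i s
  have hnorm : ∀ c : Fin d → ℝ, ∑ s, (∑ i, c i * e i s) ^ 2 = ∑ i, c i ^ 2 := by
    intro c
    have : ∀ s, (∑ i, c i * e i s) ^ 2 = ∑ i, ∑ j, c i * c j * (e i s * e j s) := by
      intro s
      rw [sq, Finset.sum_mul_sum]
      exact Finset.sum_congr rfl fun i _ => Finset.sum_congr rfl fun j _ => by ring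
    simp only [this]
    rw [Finset.sum_comm]
    refine Finset.sum_congr rfl fun i _ => ?_
    rw [Finset.sum_comm]
    simp only [← Finset.mul_sum, he, mul_ite, mul_one, mul_zero, Finset.sum_ite_eq,
      Finset.mem_univ, if_true]
    ring
  refine ⟨Finset.univ.image e ∪ Finset.univ.image u, ?_, ?_⟩
  · refine (Finset.card_union_le _ _).trans (add_le_add ?_ ?_)
    · exact Finset.card_image_le.trans (by simpa using hD)
    · refine Finset.card_image_le.trans ?_
      simpa using Nat.pow_le_pow_right two_pos hD
  intro ξ t ht hF v hv
  obtain ⟨c, hc⟩ := hW v hv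
  set z : Fin d → ℝ := fun i => ∑ s, e i s * ξ s with hz
  have hz1 : ∀ i, |z i| ≤ √t := by
    intro i
    have := hF (e i) (Finset.mem_union_left _ (Finset.mem_image_of_mem _ (Finset.mem_univ i)))
    have h1 : ∑ s, e i s ^ 2 = 1 := by
      have := he i i
      simp only [if_true] at this
      rw [← this]
      exact Finset.sum_congr rfl fun s _ => by ring
    rw [h1, mul_one] at this
    exact Real.abs_le_sqrt this
  have hlin : ∀ c : Fin d → ℝ, ∑ s, (∑ i, c i * e i s) * ξ s = ∑ i, c i * z i := by
    intro c
    simp only [Finset.sum_mul, hz, Finset.mul_sum]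
    rw [Finset.sum_comm]
    exact Finset.sum_congr rfl fun i _ => Finset.sum_congr rfl fun s _ => by ring
  have hz2 : ∑ i, |z i| ≤ √t * √D := by
    let σ : Fin d → Bool := fun i => decide (0 ≤ z i)
    have h1 := hF (u σ) (Finset.mem_union_right _ (Finset.mem_image_of_mem _ (Finset.mem_univ σ)))
    rw [hnorm, hlin] at h1
    simp only [hsg, Finset.sum_const, Finset.card_univ, Fintype.card_fin, nsmul_eq_mul,
      mul_one] at h1
    have h2 : ∑ i, sg (σ i) * z i = ∑ i, |z i| := by
      refine Finset.sum_congr rfl fun i _ => ?_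
      by_cases h : 0 ≤ z i
      · simp [sg, σ, h, abs_of_nonneg h]
      · simp [sg, σ, h, abs_of_neg (not_le.1 h)]
    rw [h2] at h1
    rw [← Real.sqrt_mul ht]
    apply Real.le_sqrt_of_sq_le
    refine h1.trans ?_
    gcongr
  have hz3 : ∑ i, z i ^ 2 ≤ √D * t := by
    calc ∑ i, z i ^ 2 = ∑ i, |z i| * |z i| := by simp [← sq]
      _ ≤ ∑ i, √t * |z i| := by gcongr with i; exact hz1 i
      _ = √t * ∑ i, |z i| := by rw [Finset.mul_sum]
      _ ≤ √t * (√t * √D) := by gcongr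
      _ = √D * t := by rw [← mul_assoc, Real.mul_self_sqrt ht, mul_comm]
  simp only [hc]
  rw [hlin, hnorm]
  refine (Finset.sum_mul_sq_le_sq_mul_sq _ _ _).trans ?_
  rw [mul_comm]
  gcongr

theorem gridMean_polynomial {p : ℕ} {q : Polynomial ℝ} (hq : q.natDegree ≤ p) :
    gridMean n (fun u => q.eval u) =
      ∑ k : Fin (p + 1), q.coeff k • gridMean n fun u => u ^ (k : ℕ) := by
  ext s
  have e : ∀ u, q.eval u = ∑ k : Fin (p + 1), q.coeff k * u ^ (k : ℕ) := by
    intro u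
    rw [Polynomial.eval_eq_sum_range' (Nat.lt_succ_of_le hq), Finset.sum_range]
  simp only [gridMean, e, Finset.sum_apply, Pi.smul_apply, smul_eq_mul]
  rw [integral_finsetSum]
  · simp only [integral_const_mul, Finset.mul_sum]
    exact Finset.sum_congr rfl fun k _ => by ring
  · intro k _
    have : Continuous fun u : ℝ => q.coeff k * u ^ (k : ℕ) := by fun_prop
    exact this.integrableOn_Icc.mono_set Ico_subset_Icc_self

theorem finrank_fragmentSpace_le (p n : ℕ) (R : Finset (Fin n)) :
    Module.finrank ℝ (fragmentSpace p n R) ≤ p + 1 := by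
  have hle : fragmentSpace p n R ≤ Submodule.span ℝ (range fun k : Fin (p + 1) =>
      restrictGrid R (gridMean n fun u => u ^ (k : ℕ))) := by
    refine Submodule.span_le.2 ?_
    rintro _ ⟨q, hq, rfl⟩
    change restrictGrid R (gridMean n fun u => q.eval u) ∈ _
    rw [gridMean_polynomial hq, map_sum]
    refine Submodule.sum_mem _ fun k _ => ?_
    rw [map_smul]
    exact Submodule.smul_mem _ _ (Submodule.subset_span ⟨k, rfl⟩)
  refine (Submodule.finrank_mono hle).trans ?_
  have := finrank_range_le_card (R := ℝ) (fun k : Fin (p + 1) =>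
      restrictGrid R (gridMean n fun u => u ^ (k : ℕ)))
  rwa [Fintype.card_fin] at this

theorem card_intervalFragments_le (n : ℕ) : (intervalFragments n).card ≤ n ^ 2 := by
  refine Finset.card_image_le.trans ((Finset.card_filter_le _ _).trans ?_)
  simp [sq]

end orthonormal

/-! ### The noise bound for positive degree -/

section noise

variable {Ω : Type*} [MeasurableSpace Ω] {P : Measure Ω} {M : Set ℕ} {β : ℝ}
  {ξ : (n : ℕ) → Fin n → Ω → ℝ}

/-- The union bound over at most `n ^ 2` intervals needs an exponent above `3`, here `3.2`, which
exceeds the `2.9` allowed per dimension. The loss of `√D` instead of `D = p + 1` compensates: `3.2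
√D ≤ 2.9 D` for `D ≥ 2`. -/
theorem TailCondition.ae_eventually_fragment_le_of_pos [IsProbabilityMeasure P] (hβ : 0 < β)
    (hξ : TailCondition P M β ξ) {p : ℕ} (hp : 0 < p) :
    ∀ᵐ ω ∂P, ∀ᶠ n in along M, ∀ R ∈ intervalFragments n, ∀ v ∈ fragmentSpace p n R,
      (∑ s, v s * ξ n s ω) ^ 2 ≤ 2.9 * β * (p + 1) * Real.log n * ∑ s, v s ^ 2 := by
  classical
  choose G hGc hG using fun (n : ℕ) (R : Finset (Fin n)) =>
    exists_test_vectors (fragmentSpace p n R) (finrank_fragmentSpace_le p n R)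
  have := hξ.ae_eventually_le hβ (fun n => (intervalFragments n).biUnion (G n))
    (K := ((p + 1 + 2 ^ (p + 1) : ℕ) : ℝ)) (x := 3.2) (y := 2) (by norm_num) (by norm_num) ?_
  · filter_upwards [this] with ω hω
    filter_upwards [hω] with n hn R hR v hv
    have hL : 0 ≤ Real.log n := Real.log_natCast_nonneg n
    refine (hG n R (fun s => ξ n s ω) (3.2 * β * Real.log n) (by positivity)
      (fun w hw => hn w (Finset.mem_biUnion.2 ⟨R, hR, hw⟩)) v hv).trans ?_
    refine mul_le_mul_of_nonneg_right ?_ (Finset.sum_nonneg fun s _ => sq_nonneg _)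
    have h2 : (2 : ℝ) ≤ p + 1 := by
      have : (1 : ℝ) ≤ p := by exact_mod_cast hp
      linarith
    have hs : √((p + 1 : ℕ) : ℝ) * 3.2 ≤ 2.9 * (p + 1) := by
      push_cast
      rw [← le_div_iff₀ (by norm_num)]
      apply Real.sqrt_le_iff.2
      constructor
      · positivity
      · have : (2.9 * ((p : ℝ) + 1) / 3.2) ^ 2 = 841 / 1024 * ((p + 1) * (p + 1)) := by
          norm_num; ring
        rw [this]
        nlinarith
    calc √((p + 1 : ℕ) : ℝ) * (3.2 * β * Real.log n)
        = (√((p + 1 : ℕ) : ℝ) * 3.2) * (β * Real.log n) := by ring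
      _ ≤ (2.9 * (p + 1)) * (β * Real.log n) := by gcongr
      _ = _ := by ring
  · intro n _
    have : ((intervalFragments n).biUnion (G n)).card ≤ n ^ 2 * (p + 1 + 2 ^ (p + 1)) := by
      refine Finset.card_biUnion_le.trans ((Finset.sum_le_sum fun R _ => hGc n R).trans ?_)
      rw [Finset.sum_const, smul_eq_mul]
      exact Nat.mul_le_mul_right _ (card_intervalFragments_le n)
    rw [Real.rpow_two, mul_comm]
    exact_mod_cast this

end noise


/-! ### The noise on constants: a sparse family of intervals -/

section sparse

variable {n : ℕ}

/-- The indicator of the discrete interval `[a, c)`. -/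
noncomputable def intervalVector (n a c : ℕ) : Fin n → ℝ :=
  fun s => if a ≤ (s : ℕ) ∧ (s : ℕ) < c then 1 else 0

theorem sum_intervalVector_sq {a c : ℕ} (hac : a ≤ c) (hcn : c ≤ n) :
    ∑ s, intervalVector n a c s ^ 2 = c - a := by
  have : ∀ s : Fin n, intervalVector n a c s ^ 2 =
      (fun k : ℕ => if a ≤ k ∧ k < c then (1 : ℝ) else 0) s := by
    intro s; simp [intervalVector]
  simp only [this]
  rw [Fin.sum_univ_eq_sum_range (fun k : ℕ => if a ≤ k ∧ k < c then (1 : ℝ) else 0) n,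
    Finset.sum_boole]
  have e : (Finset.range n).filter (fun k => a ≤ k ∧ k < c) = Finset.Ico a c := by
    ext k; simp only [Finset.mem_filter, Finset.mem_range, Finset.mem_Ico]; omega
  rw [e, Nat.card_Ico, Nat.cast_sub hac]

theorem sum_intervalVector_mul_add (ξ : Fin n → ℝ) {a b c : ℕ} (hab : a ≤ b) (hbc : b ≤ c) :
    ∑ s, intervalVector n a c s * ξ s =
      ∑ s, intervalVector n a b s * ξ s + ∑ s, intervalVector n b c s * ξ s := by
  rw [← Finset.sum_add_distrib]
  refine Finset.sum_congr rfl fun s _ => ?_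
  rw [← add_mul]
  congr 1
  unfold intervalVector
  split_ifs <;> first | omega | simp

/-- The short intervals and the intervals of blocks. -/
noncomputable def sparseFamily (n b : ℕ) : Finset (Fin n → ℝ) :=
  open Classical in
  ((Finset.range (n + 1) ×ˢ Finset.range (b ^ 2 + 1)).image
    fun q => intervalVector n q.1 (q.1 + q.2)) ∪
  ((Finset.range (n / b + 1) ×ˢ Finset.range (n / b + 1)).image
    fun q => intervalVector n (b * q.1) (b * q.2))

theorem card_sparseFamily_le (n b : ℕ) :
    (sparseFamily n b).card ≤ (n + 1) * (b ^ 2 + 1) + (n / b + 1) * (n / b + 1) := by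
  unfold sparseFamily
  refine (Finset.card_union_le _ _).trans (add_le_add ?_ ?_)
  · exact Finset.card_image_le.trans (by simp)
  · exact Finset.card_image_le.trans (by simp)

theorem short_mem_sparseFamily {b a c : ℕ} (hac : a ≤ c) (hcn : c ≤ n) (hb : c ≤ a + b ^ 2) :
    intervalVector n a c ∈ sparseFamily n b := by
  unfold sparseFamily
  refine Finset.mem_union_left _ (Finset.mem_image.2 ⟨(a, c - a), ?_, ?_⟩)
  · simp only [Finset.mem_product, Finset.mem_range]; omega
  · simp only [Nat.add_sub_cancel' hac]

theorem block_mem_sparseFamily {b k l : ℕ} (hb : 0 < b) (hkl : k ≤ l) (hl : b * l ≤ n) :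
    intervalVector n (b * k) (b * l) ∈ sparseFamily n b := by
  unfold sparseFamily
  refine Finset.mem_union_right _ (Finset.mem_image.2 ⟨(k, l), ?_, rfl⟩)
  have : l ≤ n / b := (Nat.le_div_iff_mul_le hb).2 (by rwa [mul_comm])
  simp only [Finset.mem_product, Finset.mem_range]; omega

/-- The sparse family controls all intervals up to a factor close to `1`. -/
theorem abs_sum_intervalVector_le {b : ℕ} (hb : 0 < b) {ξ : Fin n → ℝ} {t : ℝ} (ht : 0 ≤ t)
    (hF : ∀ v ∈ sparseFamily n b, (∑ s, v s * ξ s) ^ 2 ≤ t * ∑ s, v s ^ 2) {a c : ℕ}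
    (hac : a ≤ c) (hcn : c ≤ n) :
    |∑ s, intervalVector n a c s * ξ s| ≤ √t * √(c - a : ℝ) * (1 + 2 / √b) := by
  have hbR : (0 : ℝ) < b := by exact_mod_cast hb
  have hbase : ∀ a c : ℕ, a ≤ c → c ≤ n → intervalVector n a c ∈ sparseFamily n b →
      |∑ s, intervalVector n a c s * ξ s| ≤ √t * √(c - a : ℝ) := by
    intro a c hac hcn hm
    have := hF _ hm
    rw [sum_intervalVector_sq hac hcn] at this
    rw [← Real.sqrt_mul ht]
    exact Real.abs_le_sqrt this
  have hfac : 0 ≤ √t * √(c - a : ℝ) := by positivity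
  have hone : (1 : ℝ) ≤ 1 + 2 / √b := by
    have : 0 ≤ 2 / √(b : ℝ) := by positivity
    linarith
  rcases le_or_gt c (a + b ^ 2) with hs | hs
  · exact (hbase a c hac hcn (short_mem_sparseFamily hac hcn hs)).trans
      (le_mul_of_one_le_right hfac hone)
  -- A long interval is cut at `a` rounded up and `c` rounded down to multiples of `b`: a union of
  -- blocks and two remainders of length at most `b`.
  set k := (a + b - 1) / b with hk
  set l := c / b with hl
  have e1 := Nat.div_add_mod (a + b - 1) b
  have e2 := Nat.mod_lt (a + b - 1) hb
  have e3 := Nat.div_add_mod c b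
  have e4 := Nat.mod_lt c hb
  rw [← hk] at e1
  rw [← hl] at e3
  have hbb : b ≤ b ^ 2 := Nat.le_self_pow two_ne_zero b
  have k1 : a ≤ b * k := by omega
  have k2 : b * k ≤ a + b := by omega
  have l1 : b * l ≤ c := by omega
  have l2 : c ≤ b * l + b := by omega
  have hkl : k ≤ l := by
    have : b * k < b * (l + 1) := by rw [mul_add, mul_one]; omega
    have := Nat.lt_of_mul_lt_mul_left this
    omega
  have hbkl : b * k ≤ b * l := Nat.mul_le_mul_left b hkl
  rw [sum_intervalVector_mul_add ξ k1 (hbkl.trans l1), sum_intervalVector_mul_add ξ hbkl l1]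
  have f1 := hbase a (b * k) k1 (by omega) (short_mem_sparseFamily k1 (by omega) (by omega))
  have f2 := hbase (b * k) (b * l) hbkl (by omega) (block_mem_sparseFamily hb hkl (by omega))
  have f3 := hbase (b * l) c l1 hcn (short_mem_sparseFamily l1 hcn (by omega))
  have hac' : (b : ℝ) ^ 2 ≤ c - a := by
    have : ((a + b ^ 2 : ℕ) : ℝ) ≤ c := by exact_mod_cast hs.le
    push_cast at this
    linarith
  -- As `c - a ≥ b ^ 2`, each remainder has length at most `(c - a) / b`, so the two add `2 / √b` to
  -- the factor `1`.
  have hsb : √(b : ℝ) ≤ √(c - a : ℝ) / √b := by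
    rw [le_div_iff₀ (Real.sqrt_pos.2 hbR), Real.mul_self_sqrt hbR.le]
    exact Real.le_sqrt_of_sq_le hac'
  have q1 : √(((b * k : ℕ) : ℝ) - a) ≤ √(c - a : ℝ) / √b := by
    refine (Real.sqrt_le_sqrt ?_).trans hsb
    have : ((b * k : ℕ) : ℝ) ≤ ((a + b : ℕ) : ℝ) := by exact_mod_cast k2
    push_cast at this ⊢
    linarith
  have q3 : √((c : ℝ) - ((b * l : ℕ) : ℝ)) ≤ √(c - a : ℝ) / √b := by
    refine (Real.sqrt_le_sqrt ?_).trans hsb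
    have : (c : ℝ) ≤ ((b * l + b : ℕ) : ℝ) := by exact_mod_cast l2
    push_cast at this ⊢
    linarith
  have q2 : √(((b * l : ℕ) : ℝ) - ((b * k : ℕ) : ℝ)) ≤ √(c - a : ℝ) := by
    apply Real.sqrt_le_sqrt
    have h1 : ((b * l : ℕ) : ℝ) ≤ c := by exact_mod_cast l1
    have h2 : (a : ℝ) ≤ ((b * k : ℕ) : ℝ) := by exact_mod_cast k1
    linarith
  have st : 0 ≤ √t := Real.sqrt_nonneg t
  calc _ ≤ √t * √(((b * k : ℕ) : ℝ) - a) + (√t * √(((b * l : ℕ) : ℝ) - ((b * k : ℕ) : ℝ)) +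
        √t * √((c : ℝ) - ((b * l : ℕ) : ℝ))) :=
        (abs_add_le _ _).trans (add_le_add f1 ((abs_add_le _ _).trans (add_le_add f2 f3)))
    _ ≤ √t * (√(c - a : ℝ) / √b) + (√t * √(c - a : ℝ) + √t * (√(c - a : ℝ) / √b)) := by gcongr
    _ = _ := by ring

theorem mem_fragmentSpace_zero (hn : 0 < n) {i j : Fin n} {v : Fin n → ℝ}
    (hv : v ∈ fragmentSpace 0 n (Finset.Icc i j)) :
    ∃ m : ℝ, v = m • intervalVector n i (j + 1) := by
  suffices H : fragmentSpace 0 n (Finset.Icc i j) ≤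
      Submodule.span ℝ {intervalVector n i (j + 1)} by
    obtain ⟨m, hm⟩ := Submodule.mem_span_singleton.1 (H hv)
    exact ⟨m, hm.symm⟩
  refine Submodule.span_le.2 ?_
  rintro _ ⟨q, hq, rfl⟩
  refine Submodule.mem_span_singleton.2 ⟨q.coeff 0, ?_⟩
  rw [Polynomial.eq_C_of_natDegree_le_zero hq]
  ext s
  simp only [Polynomial.eval_C, Polynomial.coeff_C_zero, Pi.smul_apply, smul_eq_mul,
    indicator_apply, Finset.coe_Icc, mem_Icc, gridMean_const hn, intervalVector, Fin.le_def,
    Nat.lt_succ_iff, mul_ite, mul_one, mul_zero]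

end sparse

/-- The block length of the sparse family at stage `n`. -/
noncomputable def sparseBlock (n : ℕ) : ℕ := ⌊(n : ℝ) ^ (1 / 4 : ℝ)⌋₊

theorem one_le_sparseBlock {n : ℕ} (hn : 0 < n) : 1 ≤ sparseBlock n := by
  apply Nat.le_floor
  rw [Nat.cast_one]
  exact Real.one_le_rpow (by exact_mod_cast hn) (by norm_num)

/-- With `b` of order `n ^ (1 / 4)`, the `n b ^ 2` short intervals and the `(n / b) ^ 2` intervals
of blocks are both of order `n ^ 1.5`. -/
theorem card_sparseFamily_sparseBlock_le {n : ℕ} (hn : 0 < n) :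
    ((sparseFamily n (sparseBlock n)).card : ℝ) ≤ 13 * (n : ℝ) ^ (1.5 : ℝ) := by
  have hn1 : (1 : ℝ) ≤ n := by exact_mod_cast hn
  have hn' : (0 : ℝ) < n := by linarith
  set y := (n : ℝ) ^ (1 / 4 : ℝ) with hy
  have hy1 : 1 ≤ y := Real.one_le_rpow hn1 (by norm_num)
  have hy4 : y ^ 4 = n := by
    rw [hy, ← Real.rpow_natCast, ← Real.rpow_mul hn'.le]; norm_num
  have hy6 : y ^ 6 = (n : ℝ) ^ (1.5 : ℝ) := by
    rw [hy, ← Real.rpow_natCast, ← Real.rpow_mul hn'.le]; norm_num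
  set b := sparseBlock n with hb
  have hb1 : 1 ≤ b := one_le_sparseBlock hn
  have hb1' : (1 : ℝ) ≤ b := by exact_mod_cast hb1
  have hby : (b : ℝ) ≤ y := Nat.floor_le (by positivity)
  have hyb : y ≤ 2 * b := by
    have : y < b + 1 := Nat.lt_floor_add_one y
    linarith
  have hdiv : ((n / b : ℕ) : ℝ) ≤ 2 * y ^ 3 := by
    refine Nat.cast_div_le.trans ?_
    rw [div_le_iff₀ (by linarith), ← hy4]
    calc y ^ 4 = y ^ 3 * y := by ring
      _ ≤ y ^ 3 * (2 * b) := by gcongr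
      _ = _ := by ring
  have hc : ((sparseFamily n b).card : ℝ) ≤
      (n + 1) * (b ^ 2 + 1) + ((n / b : ℕ) + 1) * ((n / b : ℕ) + 1) := by
    exact_mod_cast card_sparseFamily_le n b
  have p2 : 1 ≤ y ^ 2 := one_le_pow₀ hy1
  have p3 : 1 ≤ y ^ 3 := one_le_pow₀ hy1
  have p4 : 1 ≤ y ^ 4 := one_le_pow₀ hy1
  rw [← hy6]
  calc _ ≤ _ := hc
    _ ≤ (y ^ 4 + y ^ 4) * (y ^ 2 + y ^ 2) + (2 * y ^ 3 + y ^ 3) * (2 * y ^ 3 + y ^ 3) := by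
        rw [hy4]; gcongr
    _ = _ := by ring

theorem eventually_sparseBlock_factor :
    ∀ᶠ n : ℕ in atTop, 2.8 * (1 + 2 / √(sparseBlock n : ℝ)) ^ 2 ≤ 2.9 := by
  have h1 : Tendsto (fun n : ℕ => (sparseBlock n : ℝ)) atTop atTop :=
    tendsto_natCast_atTop_atTop.comp (tendsto_nat_floor_atTop.comp
      ((tendsto_rpow_atTop (by norm_num)).comp tendsto_natCast_atTop_atTop))
  have h2 : Tendsto (fun n : ℕ => 2.8 * (1 + 2 / √(sparseBlock n : ℝ)) ^ 2) atTop
      (𝓝 (2.8 * (1 + 0) ^ 2)) := by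
    refine (((tendsto_const_nhds.div_atTop
      (Real.tendsto_sqrt_atTop.comp h1)).const_add 1).pow 2).const_mul 2.8
  exact (h2.eventually_lt_const (by norm_num)).mono fun n hn => hn.le

/-! ### The noise bound for constants and for every degree -/

section noise

variable {Ω : Type*} [MeasurableSpace Ω] {P : Measure Ω} {M : Set ℕ} {β : ℝ}
  {ξ : (n : ℕ) → Fin n → Ω → ℝ}

/-- In dimension `1` nothing is gained from test vectors. For the sparse family the exponent `2.8 >
1.5 + 1` suffices, and the margin up to `2.9` takes up the factor lost in passing to all intervals.
-/
theorem TailCondition.ae_eventually_fragment_le_zero [IsProbabilityMeasure P] (hβ : 0 < β)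
    (hξ : TailCondition P M β ξ) :
    ∀ᵐ ω ∂P, ∀ᶠ n in along M, ∀ R ∈ intervalFragments n, ∀ v ∈ fragmentSpace 0 n R,
      (∑ s, v s * ξ n s ω) ^ 2 ≤ 2.9 * β * Real.log n * ∑ s, v s ^ 2 := by
  have := hξ.ae_eventually_le hβ (fun n => sparseFamily n (sparseBlock n))
    (K := 13) (x := 2.8) (y := 1.5) (by norm_num) (by norm_num)
    fun n hn => card_sparseFamily_sparseBlock_le hn
  filter_upwards [this] with ω hω
  rw [eventually_along] at hω ⊢
  filter_upwards [hω, eventually_gt_atTop 0, eventually_sparseBlock_factor]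
    with n hn hn0 hfac hnM R hR v hv
  have hL : 0 ≤ Real.log n := Real.log_natCast_nonneg n
  obtain ⟨i, j, hij, rfl⟩ := mem_intervalFragments.1 hR
  obtain ⟨m, rfl⟩ := mem_fragmentSpace_zero hn0 hv
  have hij' : (i : ℕ) ≤ j + 1 := by have : (i : ℕ) ≤ j := hij; omega
  have hjn : (j : ℕ) + 1 ≤ n := j.2
  have ht : 0 ≤ 2.8 * β * Real.log n := by positivity
  have key := abs_sum_intervalVector_le (one_le_sparseBlock hn0) ht (hn hnM) hij' hjn
  have e1 : ∑ s, (m • intervalVector n i (j + 1)) s * ξ n s ω =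
      m * ∑ s, intervalVector n i (j + 1) s * ξ n s ω := by
    rw [Finset.mul_sum]
    exact Finset.sum_congr rfl fun s _ => by simp [mul_assoc]
  have e2 : ∑ s, (m • intervalVector n i (j + 1)) s ^ 2 =
      m ^ 2 * (((j + 1 : ℕ) : ℝ) - (i : ℕ)) := by
    rw [← sum_intervalVector_sq hij' hjn, Finset.mul_sum]
    exact Finset.sum_congr rfl fun s _ => by simp [mul_pow]
  rw [e1, e2, mul_pow]
  have hd : 0 ≤ ((j + 1 : ℕ) : ℝ) - (i : ℕ) := by
    rw [sub_nonneg]; exact_mod_cast hij'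
  set Z := ∑ s, intervalVector n i (j + 1) s * ξ n s ω
  set d := ((j + 1 : ℕ) : ℝ) - (i : ℕ)
  have hZ : Z ^ 2 ≤ 2.9 * β * Real.log n * d := by
    calc Z ^ 2 = |Z| ^ 2 := (sq_abs _).symm
      _ ≤ (√(2.8 * β * Real.log n) * √d * (1 + 2 / √(sparseBlock n : ℝ))) ^ 2 := by gcongr
      _ = (2.8 * (1 + 2 / √(sparseBlock n : ℝ)) ^ 2) * (β * Real.log n * d) := by
          rw [mul_pow, mul_pow, Real.sq_sqrt ht, Real.sq_sqrt hd]; ring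
      _ ≤ 2.9 * (β * Real.log n * d) := by gcongr
      _ = _ := by ring
  calc m ^ 2 * Z ^ 2 ≤ m ^ 2 * (2.9 * β * Real.log n * d) := by gcongr
    _ = _ := by ring

theorem TailCondition.ae_eventually_fragment_le [IsProbabilityMeasure P] (hβ : 0 < β)
    (hξ : TailCondition P M β ξ) (p : ℕ) :
    ∀ᵐ ω ∂P, ∀ᶠ n in along M, ∀ R ∈ intervalFragments n, ∀ v ∈ fragmentSpace p n R,
      (∑ s, v s * ξ n s ω) ^ 2 ≤ 2.9 * β * (p + 1) * Real.log n * ∑ s, v s ^ 2 := by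
  rcases Nat.eq_zero_or_pos p with rfl | hp
  · simpa using hξ.ae_eventually_fragment_le_zero hβ
  · exact hξ.ae_eventually_fragment_le_of_pos hβ hp

end noise


/-! ### The rate -/

theorem injOn_Icc_fin (n : ℕ) : Set.InjOn (fun q : Fin n × Fin n => Finset.Icc q.1 q.2)
    ((Finset.univ.filter fun q : Fin n × Fin n => q.1 ≤ q.2 : Finset (Fin n × Fin n)) :
      Set (Fin n × Fin n)) := by
  rintro ⟨a, b⟩ hab ⟨c, d⟩ hcd he
  simp only [Finset.coe_filter, Finset.mem_univ, true_and, mem_ofPred_eq] at hab hcd he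
  have h1 := Finset.ext_iff.1 he
  simp only [Finset.mem_Icc] at h1
  have a1 := (h1 a).1 ⟨le_rfl, hab⟩
  have a2 := (h1 b).1 ⟨hab, le_rfl⟩
  have a3 := (h1 c).2 ⟨le_rfl, hcd⟩
  have a4 := (h1 d).2 ⟨hcd, le_rfl⟩
  rw [le_antisymm a3.1 a1.1, le_antisymm a2.2 a4.2]

theorem sq_le_two_mul_card_intervalFragments (n : ℕ) :
    n ^ 2 ≤ 2 * (intervalFragments n).card := by
  classical
  rw [intervalFragments, Finset.card_image_of_injOn (injOn_Icc_fin n)]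
  set A := Finset.univ.filter fun q : Fin n × Fin n => q.1 ≤ q.2
  have : (Finset.univ : Finset (Fin n × Fin n)) ⊆ A ∪ A.image Prod.swap := by
    rintro ⟨a, b⟩ -
    rcases le_total a b with h | h
    · exact Finset.mem_union_left _ (by simp [A, h])
    · exact Finset.mem_union_right _ (Finset.mem_image.2 ⟨(b, a), by simp [A, h], rfl⟩)
  have h2 := (Finset.card_le_card this).trans (Finset.card_union_le _ _)
  have h3 : (A.image Prod.swap).card ≤ A.card := Finset.card_image_le
  simp only [Finset.card_univ, Fintype.card_prod, Fintype.card_fin] at h2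
  rw [sq]; omega

/-- From `|R^n| ≥ n ^ 2 / 2` the right side is at least `3 ln n - 1.5 ln 2`; the constant is below
`0.05 ln n` once `ln n ≥ 30 ln 2`. -/
theorem eventually_log_card_intervalFragments :
    ∀ᶠ n : ℕ in atTop, 2.95 * Real.log n ≤ 1.5 * Real.log ((intervalFragments n).card : ℝ) := by
  have h1 : ∀ᶠ n : ℕ in atTop, 30 * Real.log 2 ≤ Real.log n :=
    (Real.tendsto_log_atTop.comp tendsto_natCast_atTop_atTop).eventually_ge_atTop _
  filter_upwards [h1, eventually_gt_atTop 0] with n hn hn0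
  have hn' : (0 : ℝ) < n := by exact_mod_cast hn0
  have h2 : (n : ℝ) ^ 2 / 2 ≤ (intervalFragments n).card := by
    rw [div_le_iff₀ two_pos, mul_comm]
    exact_mod_cast sq_le_two_mul_card_intervalFragments n
  have h3 := Real.log_le_log (by positivity) h2
  rw [Real.log_div (by positivity) two_ne_zero, Real.log_pow] at h3
  push_cast at h3
  linarith

/-! ### From the single-stage bound to the almost sure rate -/

section rate

variable {Ω : Type*} [MeasurableSpace Ω] {P : Measure Ω} {M : Set ℕ} {β : ℝ}
  {ξ : (n : ℕ) → Fin n → Ω → ℝ}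

/-- The error bound at a single stage. -/
theorem sqError_le_of_noise_bound {α β : ℝ} (hα : 0 < α) (hβ : 0 < β) {p : ℕ}
    (hαp : α < p + 1) {J : ℕ} {f : ℝ → ℝ} (hf : PiecewiseSobolev α J f) :
    ∃ K : ℝ, ∀ (n : ℕ) (γ : ℝ) (ξ : Fin n → ℝ), 0 < n → 1 ≤ Real.log n → 0 < γ → γ ≤ 1 →
      2.95 * β * (p + 1) * Real.log n ≤ n * γ →
      (∀ R ∈ intervalFragments n, ∀ v ∈ fragmentSpace p n R,
        (∑ s, v s * ξ s) ^ 2 ≤ 2.9 * β * (p + 1) * Real.log n * ∑ s, v s ^ 2) →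
      ∀ Q h, IsEstimate p γ (fun s => gridMean n f s + ξ s) Q h →
        sqError n h f ≤ K * γ ^ (2 * α / (2 * α + 1)) := by
  obtain ⟨hf2, S, hS, ⟨ν, hν, hνq⟩, ⟨ν', hν', hνm⟩, C, hC0, hC⟩ := hf.exists_estimates hα
  have hfl : ⌊α⌋₊ ≤ p := by
    rw [← Nat.lt_succ_iff, Nat.floor_lt hα.le]
    push_cast
    exact hαp
  have hνq' : ∀ c d, 0 ≤ c → c < d → d ≤ 1 → (∀ t ∈ S, t ∉ Ioo c d) →
      ∃ q : Polynomial ℝ, q.natDegree ≤ p ∧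
        ∫ x in Ioo c d, (f x - q.eval x) ^ 2 ≤ (d - c) ^ (2 * α) * ν.real (Ioo c d) := by
    intro c d h1 h2 h3 h4
    obtain ⟨q, hq, hq'⟩ := hνq c d h1 h2 h3 h4
    exact ⟨q, hq.trans hfl, hq'⟩
  set r := 2 * α / (2 * α + 1) with hr
  set c₀ := 2.95 * β * ((p : ℝ) + 1) with hc₀
  have hc₀pos : 0 < c₀ := by positivity
  -- The ratio `2.9 / 2.95` of the constants in the noise bound and in the penalty bound.
  set θ : ℝ := 58 / 59 with hθ
  set K₀ : ℝ := 2 / (1 - θ) * (4 + 2 / (1 - θ)) with hK₀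
  have hK₀0 : 0 ≤ K₀ := by rw [hK₀, hθ]; norm_num
  refine ⟨2 * (K₀ * ((1 + (2 * S.card + 1)) + (1 + 1 / c₀) ^ (2 * α) * ν.real univ)) +
    2 * ((ν'.real univ + S.card * C) * (1 / c₀) ^ r), ?_⟩
  intro n γ ξ hn hlog hγ hγ1 hpen hnoise Q h hest
  have hn' : (0 : ℝ) < n := by exact_mod_cast hn
  have hr0 : 0 ≤ r := by positivity
  have hr1 : r ≤ 1 := by rw [hr, div_le_one (by positivity)]; linarith
  have hX : 0 < γ ^ r := by positivity
  have hγX : γ ≤ γ ^ r := by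
    nth_rewrite 1 [← Real.rpow_one γ]
    exact Real.rpow_le_rpow_of_exponent_ge hγ hγ1 hr1
  -- The penalty dominates the mesh size, so rounding to the grid and discretization cost no more
  -- than the rate.
  have hinv : 1 / (n : ℝ) ≤ 1 / c₀ * γ := by
    rw [div_mul_eq_mul_div, one_mul, div_le_div_iff₀ hn' hc₀pos]
    have : c₀ * 1 ≤ c₀ * Real.log n := by gcongr
    linarith
  -- The block length that balances penalty and approximation: `γ / l = l ^ (2 α) = γ ^ r`.
  set l := γ ^ (1 / (2 * α + 1)) with hl
  have hl0 : 0 < l := by positivity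
  have hγl : γ ≤ l := by
    nth_rewrite 1 [← Real.rpow_one γ]
    apply Real.rpow_le_rpow_of_exponent_ge hγ hγ1
    rw [div_le_one (by positivity)]; linarith
  have hlX : l ^ (2 * α) = γ ^ r := by
    rw [hl, ← Real.rpow_mul hγ.le, hr]; congr 1; ring
  have hγdl : γ / l = γ ^ r := by
    rw [hl, div_eq_iff (by positivity), ← Real.rpow_add hγ]
    rw [show r + 1 / (2 * α + 1) = 1 by rw [hr]; field_simp, Real.rpow_one]
  set m := ⌈(n : ℝ) * l⌉₊ with hm
  have hm0 : 0 < m := Nat.ceil_pos.2 (by positivity)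
  have hm0' : (0 : ℝ) < m := by exact_mod_cast hm0
  have hmge : (n : ℝ) * l ≤ m := Nat.le_ceil _
  have hmle : (m : ℝ) ≤ n * l + 1 := (Nat.ceil_lt_add_one (by positivity)).le
  have hmn : (m : ℝ) / n ≤ (1 + 1 / c₀) * l := by
    calc (m : ℝ) / n ≤ (n * l + 1) / n := by gcongr
      _ = l + 1 / n := by field_simp
      _ ≤ l + 1 / c₀ * l := by
        have : 1 / c₀ * γ ≤ 1 / c₀ * l := by gcongr
        linarith
      _ = _ := by ring
  obtain ⟨Q', h', hseg, hcard, herr⟩ := exists_segmentation hα hf2 hS hνq' hn hm0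
  have hT : ∀ R ∈ intervalFragments n, ∀ v ∈ fragmentSpace p n R,
      (∑ s, v s * ξ s) ^ 2 ≤ θ * (n * γ) * ∑ s, v s ^ 2 := by
    intro R hR v hv
    refine (hnoise R hR v hv).trans ?_
    refine mul_le_mul_of_nonneg_right ?_ (Finset.sum_nonneg fun s _ => sq_nonneg _)
    calc 2.9 * β * (p + 1) * Real.log n = θ * (c₀ * Real.log n) := by
          rw [hθ, hc₀]; ring
      _ ≤ θ * (n * γ) := by gcongr
  have horacle := oracle_inequality hn hγ (by norm_num) (by norm_num) hT hest hseg
  have hcardR : γ * (Q'.parts.card : ℝ) ≤ (1 + (2 * S.card + 1)) * γ ^ r := by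
    have h1 : (Q'.parts.card : ℝ) ≤ 1 / l + (2 * S.card + 1) := by
      have h2 : (Q'.parts.card : ℝ) ≤ (n / m : ℕ) + 2 * S.card + 1 := by exact_mod_cast hcard
      have h3 : ((n / m : ℕ) : ℝ) ≤ 1 / l := by
        refine Nat.cast_div_le.trans ?_
        rw [div_le_div_iff₀ hm0' hl0]
        linarith
      linarith
    calc γ * (Q'.parts.card : ℝ) ≤ γ * (1 / l + (2 * S.card + 1)) := by gcongr
      _ = γ / l + (2 * S.card + 1) * γ := by ring
      _ ≤ γ ^ r + (2 * S.card + 1) * γ ^ r := by rw [hγdl]; gcongr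
      _ = _ := by ring
  have herrR : (∑ s, (gridMean n f s - h' s) ^ 2) / n ≤
      (1 + 1 / c₀) ^ (2 * α) * ν.real univ * γ ^ r := by
    calc _ ≤ _ := herr
      _ ≤ ((1 + 1 / c₀) * l) ^ (2 * α) * ν.real univ := by gcongr
      _ = _ := by rw [Real.mul_rpow (by positivity) hl0.le, hlX]; ring
  have hdisc := sum_integral_sub_gridMean_sq_le hα hf2 hνm hC0 hC hn
  have hinvr : (1 / n : ℝ) ^ r ≤ (1 / c₀) ^ r * γ ^ r := by
    rw [← Real.mul_rpow (by positivity) hγ.le]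
    exact Real.rpow_le_rpow (by positivity) hinv hr0
  have hD0 : 0 ≤ ν'.real univ + S.card * C := by positivity
  calc sqError n h f ≤ _ := sqError_le hn h hf2
    _ ≤ 2 * (K₀ * ((1 + (2 * S.card + 1)) * γ ^ r +
          (1 + 1 / c₀) ^ (2 * α) * ν.real univ * γ ^ r)) +
        2 * ((ν'.real univ + S.card * C) * ((1 / c₀) ^ r * γ ^ r)) := by
        gcongr
        · refine horacle.trans ?_
          gcongr
        · refine hdisc.trans ?_
          gcongr
    _ = _ := by ring

/-- Positivity of `γ` is only required eventually because `C ln n / n` vanishes at `n = 1`; the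
bound on `n γ n` covers both forms of the penalty. -/
theorem rate_of_eventually_penalty [IsProbabilityMeasure P] (hβ : 0 < β)
    (hξ : TailCondition P M β ξ) {p : ℕ} {γ : ℕ → ℝ} (hγ : ∀ᶠ n in along M, 0 < γ n)
    (hγ0 : Tendsto γ (along M) (𝓝 0))
    (hpen : ∀ᶠ n : ℕ in along M, 2.95 * β * (p + 1) * Real.log n ≤ n * γ n)
    {α : ℝ} {J : ℕ} {f : ℝ → ℝ} (hα : 0 < α) (hαp : α < p + 1) (hf : PiecewiseSobolev α J f)
    {Qhat : (n : ℕ) → Ω → Finpartition (Finset.univ : Finset (Fin n))}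
    {fhat : (n : ℕ) → Ω → Fin n → ℝ}
    (hest : ∀ n ∈ M, ∀ ω,
      IsEstimate p (γ n) (fun s => gridMean n f s + ξ n s ω) (Qhat n ω) (fhat n ω)) :
    ∀ᵐ ω ∂P, (fun n => sqError n (fhat n ω) f) =O[along M]
      fun n => γ n ^ (2 * α / (2 * α + 1)) := by
  obtain ⟨K, hK⟩ := sqError_le_of_noise_bound hα hβ hαp hf
  have h1 : ∀ᶠ n : ℕ in along M, 0 < n ∧ 1 ≤ Real.log n := by
    refine eventually_along.2 ?_
    filter_upwards [eventually_gt_atTop 0,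
      (Real.tendsto_log_atTop.comp tendsto_natCast_atTop_atTop).eventually_ge_atTop 1]
      with n hn hn' _ using ⟨hn, hn'⟩
  have hM : ∀ᶠ n in along M, n ∈ M := eventually_along.2 (Eventually.of_forall fun _ h => h)
  filter_upwards [hξ.ae_eventually_fragment_le hβ p] with ω hω
  refine IsBigO.of_bound K ?_
  filter_upwards [hω, hγ, hγ0.eventually_le_const one_pos, hpen, h1, hM]
    with n hnoise hγn hγ1 hpenn hn hnM
  have hX : 0 ≤ γ n ^ (2 * α / (2 * α + 1)) := by positivity
  have hE : 0 ≤ sqError n (fhat n ω) f := integral_nonneg fun _ => sq_nonneg _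
  rw [Real.norm_of_nonneg hE, Real.norm_of_nonneg hX]
  exact hK n (γ n) (fun s => ξ n s ω) hn.1 hn.2 hγn hγ1 hpenn hnoise _ _ (hest n hnM ω)

end rate

theorem mainTheorem5 {Ω : Type*} [MeasurableSpace Ω] (P : Measure Ω) [IsProbabilityMeasure P]
    (M : Set ℕ) (hM : M.Infinite) (p : ℕ) (β : ℝ) (hβ : 0 < β)
    (ξ : (n : ℕ) → Fin n → Ω → ℝ) (hmeas : ∀ n ∈ M, ∀ s, Measurable (ξ n s))
    (hξ : TailCondition P M β ξ) :
    -- the rate, for all admissible penalty parameters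
    (∀ γ : ℕ → ℝ, PenaltyCondition M β (p + 1) 2 γ →
      ∀ (α : ℝ) (J : ℕ) (f : ℝ → ℝ), 0 < α → α < p + 1 → PiecewiseSobolev α J f →
      ∀ (Qhat : (n : ℕ) → Ω → Finpartition (Finset.univ : Finset (Fin n)))
        (fhat : (n : ℕ) → Ω → Fin n → ℝ),
        (∀ n ∈ M, ∀ ω,
          IsEstimate p (γ n) (fun s => gridMean n f s + ξ n s ω) (Qhat n ω) (fhat n ω)) →
        ∀ᵐ ω ∂P, (fun n => sqError n (fhat n ω) f) =O[along M]
          fun n => γ n ^ (2 * α / (2 * α + 1))) ∧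
    -- the choice `γ n = C ln n / n`, with `C` independent of `f` and of its smoothness
    (∀ C : ℝ, 3 * β * (p + 1) ≤ C →
      ∀ (α : ℝ) (J : ℕ) (f : ℝ → ℝ), 0 < α → α < p + 1 → PiecewiseSobolev α J f →
      ∀ (Qhat : (n : ℕ) → Ω → Finpartition (Finset.univ : Finset (Fin n)))
        (fhat : (n : ℕ) → Ω → Fin n → ℝ),
        (∀ n ∈ M, ∀ ω,
          IsEstimate p (C * (Real.log n / n)) (fun s => gridMean n f s + ξ n s ω)
            (Qhat n ω) (fhat n ω)) →
        ∀ᵐ ω ∂P, (fun n => sqError n (fhat n ω) f) =O[along M]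
          fun n => (Real.log n / n) ^ (2 * α / (2 * α + 1))) := by
  have hMev : ∀ᶠ n in along M, n ∈ M := eventually_along.2 (Eventually.of_forall fun _ h => h)
  have hle : along M ≤ atTop := inf_le_left
  constructor
  · rintro γ ⟨hpos, h0, hpen⟩ α J f hα hαp hf Qhat fhat hest
    refine rate_of_eventually_penalty hβ hξ (hMev.mono fun n hn => hpos n hn) h0 ?_ hα hαp hf hest
    filter_upwards [hpen, eventually_log_card_intervalFragments.filter_mono hle,
      (eventually_gt_atTop 0).filter_mono hle] with n hn hlog hn0
    have hn' : (0 : ℝ) < n := by exact_mod_cast hn0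
    -- For `κ = 2` the factor `(κ + 1) / κ` of the penalty condition is `1.5`.
    calc 2.95 * β * (p + 1) * Real.log n = β * (p + 1) * (2.95 * Real.log n) := by ring
      _ ≤ β * (p + 1) * (1.5 * Real.log ((intervalFragments n).card : ℝ)) := by gcongr
      _ = n * (β * (p + 1) * (2 + 1) / 2 *
          (Real.log ((intervalFragments n).card : ℝ) / n)) := by
          field_simp; norm_num; ring
      _ ≤ n * γ n := by gcongr
  · intro C hC α J f hα hαp hf Qhat fhat hest
    have hCpos : 0 < C := lt_of_lt_of_le (by positivity) hC
    have h0 : Tendsto (fun n : ℕ => C * (Real.log n / n)) (along M) (𝓝 0) := by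
      have h1 : Tendsto (fun n : ℕ => Real.log n / n) atTop (𝓝 0) :=
        Real.isLittleO_log_id_atTop.tendsto_div_nhds_zero.comp tendsto_natCast_atTop_atTop
      simpa using (h1.const_mul C).mono_left hle
    have h1 : ∀ᶠ n : ℕ in along M, 0 < C * (Real.log n / n) := by
      filter_upwards [(eventually_gt_atTop 1).filter_mono hle] with n hn
      have hn1 : (1 : ℝ) < n := by exact_mod_cast hn
      have := Real.log_pos hn1
      positivity
    have h2 : ∀ᶠ n : ℕ in along M,
        2.95 * β * (p + 1) * Real.log n ≤ n * (C * (Real.log n / n)) := by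
      filter_upwards [(eventually_gt_atTop 0).filter_mono hle] with n hn
      have hn' : (n : ℝ) ≠ 0 := by exact_mod_cast hn.ne'
      have hL : 0 ≤ Real.log n := Real.log_natCast_nonneg n
      have e : n * (C * (Real.log n / n)) = C * Real.log n := by field_simp
      rw [e]
      refine mul_le_mul_of_nonneg_right (le_trans ?_ hC) hL
      gcongr
      norm_num
    filter_upwards [rate_of_eventually_penalty hβ hξ h1 h0 h2 hα hαp hf hest] with ω hω
    refine hω.trans ?_
    have e : ∀ n : ℕ, (C * (Real.log n / n)) ^ (2 * α / (2 * α + 1)) =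
        C ^ (2 * α / (2 * α + 1)) * (Real.log n / n) ^ (2 * α / (2 * α + 1)) := fun n =>
      Real.mul_rpow hCpos.le (div_nonneg (Real.log_natCast_nonneg n) (Nat.cast_nonneg n))
    simp only [e]
    exact (isBigO_refl _ _).const_mul_left _
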